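/- Let $d\ge 1$ and $0<r_{\min}\le r_{\max}<1$. Let $S_d$ be the set of similarities $f:\mathbb R^d\to\mathbb R^d$ with contraction ratio in $[r_{\min},r_{\max}]$ that map the closed unit ball into itself, with the Borel $\sigma$-algebra of the topology of pointwise convergence. Let $\Lambda=\bigcup_{k\ge1}S_d^k$, with the $\sigma$-algebra of all sets whose trace on each $S_d^k$ is measurable for the product $\sigma$-algebra, let $\mathbb P_1$ be a probability measure on $\Lambda$, and let $\mathbb P=\mathbb P_1^{\mathbb N}$ on $\Omega=\Lambda^{\mathbb N}$. For $\lambda=(f_\lambda^1,\dots,f_\lambda^{N_\lambda})\in\Lambda$ write $r_\lambda^i$ for the contraction ratio of $f_\lambda^i$. For $\omega=(\omega_1,\omega_2,\dots)\in\Omega$ let $\Sigma(\omega)=\prod_{i\ge1}\{1,\dots,N_{\omega_i}\}$ and, for $v\in\Sigma(\omega)$ and $n\ge1$, write $f_\omega^{v|_n}=f_{\omega_1}^{v_1}\circ\dots\circ f_{\omega_n}^{v_n}$ and $r_\omega^{v|_n}=r_{\omega_1}^{v_1}\cdots r_{\omega_n}^{v_n}$. The attractor is \[F_\omega=\Big\{\lim_{n\to\infty}f_\omega^{v|_n}(0)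 : v\in\Sigma(\omega)\Big\}.\] Assume: (i) (uniform cylinder separation) there are $\gamma>0$ and $x_0\in\mathbb R^d$ such that for $\mathbb P$-almost all $\omega$, for all $v,w\in\Sigma(\omega)$ and $n,m\ge1$ with $v|_n\ne w|_m$, \[|f_\omega^{v|_n}(x_0)-f_\omega^{w|_m}(x_0)|\ge\gamma\min\{r_\omega^{v|_n},r_\omega^{w|_m}\};\] (ii) (not almost deterministic) there is no $s\in\mathbb R$ with $\sum_{i=1}^{N_\lambda}(r_\lambda^i)^s=1$ for $\mathbb P_1$-almost all $\lambda$; (iii) $2\le\operatorname{ess\,sup}_{\lambda\sim\mathbb P_1}N_\lambda<\infty$; (iv) (equicontractivity) for $\mathbb P_1$-almost all $\lambda$ there is $r_\lambda$ with $r_\lambda^i=r_\lambda$ for all $1\le i\le N_\lambda$. For compact $K\subset\mathbb R^d$ let $\langle K\rangle_\varepsilon$ be its closed $\varepsilon$-neighbourhood and $\mathcal L^d$ Lebesgue measure. The Minkowski dimension of $K$ is the critical exponent $s$ such that, as $\varepsilon\to0$, $\varepsilon^{t-d}\mathcal L^d(\langle K\rangle_\varepsilon)\to\infty$ for all $t<s$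 and $\varepsilon^{t-d}\mathcal L^d(\langle K\rangle_\varepsilon)\to0$ for all $t>s$. Then there is a (unique) number $s\in\mathbb R$ which is the Minkowski dimension of $F_\omega$ for $\mathbb P$-almost all $\omega$, and for this $s$, $\mathbb P$-almost surely, \[\underline{\mathcal M}^s(F_\omega)=\liminf_{\varepsilon\to0}\varepsilon^{s-d}\mathcal L^d(\langle F_\omega\rangle_\varepsilon)=0,\qquad \overline{\mathcal M}^s(F_\omega)=\limsup_{\varepsilon\to0}\varepsilon^{s-d}\mathcal L^d(\langle F_\omega\rangle_\varepsilon)=\infty,\] and the lower and the upper average Minkowski content, that is, the lower and the upper limit as $\delta\to0$ of \[\frac1{|\log\delta|}\int_\delta^1\varepsilon^{s-d}\mathcal L^d(\langle F_\omega\rangle_\varepsilon)\frac1\varepsilon\,d\varepsilon,\] are both $\infty$; hence the average Minkowski content $\lim_{\delta\to0}$ of this expression exists and is $\infty$. -/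

import Mathlib

open MeasureTheory Filter Topology
open scoped ENNReal

noncomputable section

namespace RIFS

/-- The Euclidean space `ℝ^d`. -/
abbrev E (d : ℕ) : Type := EuclideanSpace ℝ (Fin d)

/-! ### Minkowski contents and Minkowski dimension -/

/-- The quantity `ε^(s-d) * L^d(⟨K⟩_ε)`, where `⟨K⟩_ε` is the closed `ε`-neighbourhood of `K`.
It is meant for `ε > 0`. -/
def scaledVolume {d : ℕ} (s : ℝ) (K : Set (E d)) (ε : ℝ) : ℝ≥0∞ :=
  ENNReal.ofReal (ε ^ (s - (d : ℝ))) * volume (Metric.cthickening ε K)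

/-- The lower `s`-dimensional Minkowski content. -/
def lowerMinkowskiContent {d : ℕ} (s : ℝ) (K : Set (E d)) : ℝ≥0∞ :=
  liminf (scaledVolume s K) (𝓝[>] (0 : ℝ))

/-- The upper `s`-dimensional Minkowski content. -/
def upperMinkowskiContent {d : ℕ} (s : ℝ) (K : Set (E d)) : ℝ≥0∞ :=
  limsup (scaledVolume s K) (𝓝[>] (0 : ℝ))

/-- The logarithmic average `|log δ|⁻¹ * ∫_δ^1 ε^(s-d) * L^d(⟨K⟩_ε) * ε⁻¹ dε`. -/
def logAverage {d : ℕ} (s : ℝ) (K : Set (E d)) (δ : ℝ) : ℝ≥0∞ :=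
  (∫⁻ ε in Set.Icc δ 1, scaledVolume s K ε * ENNReal.ofReal (1 / ε)) /
    ENNReal.ofReal |Real.log δ|

/-- The lower average `s`-dimensional Minkowski content. -/
def lowerAverageMinkowskiContent {d : ℕ} (s : ℝ) (K : Set (E d)) : ℝ≥0∞ :=
  liminf (logAverage s K) (𝓝[>] (0 : ℝ))

/-- The upper average `s`-dimensional Minkowski content. -/
def upperAverageMinkowskiContent {d : ℕ} (s : ℝ) (K : Set (E d)) : ℝ≥0∞ :=
  limsup (logAverage s K) (𝓝[>] (0 : ℝ))

/-- The `s`-dimensional average Minkowski content exists in `[0, ∞]` and equals `c`. -/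
def HasAverageMinkowskiContent {d : ℕ} (s : ℝ) (K : Set (E d)) (c : ℝ≥0∞) : Prop :=
  Tendsto (logAverage s K) (𝓝[>] (0 : ℝ)) (𝓝 c)

/-- `K` has Minkowski dimension `s`: the number `s` is the critical exponent at which the
`t`-dimensional Minkowski content of `K` jumps from `∞` (for `t < s`) to `0` (for `t > s`). -/
def HasMinkowskiDim {d : ℕ} (K : Set (E d)) (s : ℝ) : Prop :=
  (∀ t : ℝ, t < s → Tendsto (scaledVolume t K) (𝓝[>] (0 : ℝ)) (𝓝 ∞)) ∧
    ∀ t : ℝ, s < t → Tendsto (scaledVolume t K) (𝓝[>] (0 : ℝ)) (𝓝 0)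

/-- The Minkowski dimension is unique. -/
theorem HasMinkowskiDim.unique {d : ℕ} {K : Set (E d)} {s t : ℝ} (hs : HasMinkowskiDim K s)
    (ht : HasMinkowskiDim K t) : s = t := by
  have key : ∀ a b : ℝ, HasMinkowskiDim K a → HasMinkowskiDim K b → ¬ a < b := by
    intro a b ha hb hab
    obtain ⟨c, hac, hcb⟩ := exists_between hab
    exact ENNReal.zero_ne_top (tendsto_nhds_unique (ha.2 c hac) (hb.1 c hcb))
  exact le_antisymm (not_lt.1 (key t s ht hs)) (not_lt.1 (key s t hs ht))

/-! ### Random iterated function systems -/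

/-- The set `S_d` of the similarities of `ℝ^d` that map the closed unit ball into itself and whose
contraction ratio lies in `[rmin, rmax]`. -/
def Sim (d : ℕ) (rmin rmax : ℝ) : Type :=
  {f : E d →ᵈ E d //
    (rmin ≤ (Dilation.ratio f : ℝ) ∧ (Dilation.ratio f : ℝ) ≤ rmax) ∧
      f '' Metric.closedBall 0 1 ⊆ Metric.closedBall 0 1}

variable {d : ℕ} {rmin rmax : ℝ}

/-- The underlying map `ℝ^d → ℝ^d`. -/
def Sim.map (f : Sim d rmin rmax) : E d → E d := fun x => f.1 x

/-- The contraction ratio. -/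
def Sim.ratio (f : Sim d rmin rmax) : ℝ := (Dilation.ratio f.1 : ℝ)

/-- The topology of pointwise convergence on `S_d`. -/
instance : TopologicalSpace (Sim d rmin rmax) :=
  TopologicalSpace.induced Sim.map Pi.topologicalSpace

/-- The Borel `σ`-algebra of the topology of pointwise convergence. -/
instance : MeasurableSpace (Sim d rmin rmax) := borel _

instance : BorelSpace (Sim d rmin rmax) := ⟨rfl⟩

/-- The space `Λ` of non-empty finite tuples of elements of `S_d`. Its `σ`-algebra (the instance on
sigma types) consists of the sets whose trace on each `S_d^k` lies in the product `σ`-algebra. -/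
abbrev Tuple (d : ℕ) (rmin rmax : ℝ) : Type := Σ k : ℕ+, Fin (k : ℕ) → Sim d rmin rmax

/-- The number `N_λ` of maps in the tuple `λ`. -/
def Tuple.N (l : Tuple d rmin rmax) : ℕ := (l.1 : ℕ)

/-- The contraction ratio of the `i`-th map of the tuple. -/
def Tuple.ratio (l : Tuple d rmin rmax) (i : Fin l.N) : ℝ := (l.2 i).ratio

/-- The `i`-th map of the tuple. -/
def Tuple.map (l : Tuple d rmin rmax) (i : Fin l.N) : E d → E d := (l.2 i).map

/-- The infinite codings `Σ(ω)`. -/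
abbrev Coding (ω : ℕ → Tuple d rmin rmax) : Type := (i : ℕ) → Fin (ω i).N

/-- The composition `f_{ω_1}^{v_1} ∘ ⋯ ∘ f_{ω_n}^{v_n}`; levels are indexed from `0`. -/
def cylinderMap (ω : ℕ → Tuple d rmin rmax) (v : Coding ω) : ℕ → E d → E d
  | 0 => id
  | n + 1 => cylinderMap ω v n ∘ (ω n).map (v n)

/-- The product `r_{ω_1}^{v_1} ⋯ r_{ω_n}^{v_n}`. -/
def cylinderRatio (ω : ℕ → Tuple d rmin rmax) (v : Coding ω) (n : ℕ) : ℝ :=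
  ∏ i ∈ Finset.range n, (ω i).ratio (v i)

/-- The attractor `F_ω`: the set of the limits `lim_n f_{ω_1}^{v_1} ∘ ⋯ ∘ f_{ω_n}^{v_n}(0)`
over all codings `v`. -/
def attractor (ω : ℕ → Tuple d rmin rmax) : Set (E d) :=
  {x | ∃ v : Coding ω, Tendsto (fun n => cylinderMap ω v n 0) atTop (𝓝 x)}

/-- The law `P = P₁^ℕ` of the random iterated function system. -/
def law (P₁ : Measure (Tuple d rmin rmax)) [IsProbabilityMeasure P₁] :
    Measure (ℕ → Tuple d rmin rmax) :=
  Measure.infinitePi fun _ : ℕ => P₁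

/-- The uniform cylinder separation condition. The words `v|_n` and `w|_m` are equal exactly when
they have the same length and the same letters. -/
def UniformCylinderSeparation (P₁ : Measure (Tuple d rmin rmax)) [IsProbabilityMeasure P₁] : Prop :=
  ∃ γ : ℝ, 0 < γ ∧ ∃ x₀ : E d, ∀ᵐ ω ∂(law P₁), ∀ v w : Coding ω, ∀ n m : ℕ, 1 ≤ n → 1 ≤ m →
    ¬ (n = m ∧ ∀ i < n, v i = w i) →
      γ * min (cylinderRatio ω v n) (cylinderRatio ω w m) ≤
        ‖cylinderMap ω v n x₀ - cylinderMap ω w m x₀‖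

/-- The system is almost deterministic: for some real `s`, almost surely
`∑_i (r_λ^i)^s = 1`. -/
def AlmostDeterministic (P₁ : Measure (Tuple d rmin rmax)) : Prop :=
  ∃ s : ℝ, ∀ᵐ l ∂P₁, ∑ i : Fin l.N, l.ratio i ^ s = 1

/-- Almost surely all the maps of the random tuple have the same contraction ratio. -/
def Equicontractive (P₁ : Measure (Tuple d rmin rmax)) : Prop :=
  ∀ᵐ l ∂P₁, ∃ r : ℝ, ∀ i : Fin l.N, l.ratio i = r

/-- The essential supremum of the number of maps, in `ℕ ∪ {∞}`. -/
def essSupN (P₁ : Measure (Tuple d rmin rmax)) : ℕ∞ :=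
  essSup (fun l => (l.N : ℕ∞)) P₁

end RIFS

end

noncomputable section

namespace RIFS

/-! ### Random walks with bounded centred independent increments -/

/-! Equicontractivity makes all level-`n` cylinders of `ω` have one common ratio `R_n = r_1 ⋯ r_n`.
At scales comparable to `R_n` the neighbourhood of the attractor is covered by one ball of radius
comparable to `R_n` per word, and separation puts disjoint balls of comparable radius inside it.
Hence the `t`-scaled volume there is comparable to the partition sum `W_n(t) = ∏ N_i r_i^t`
(`exists_scaledVolume_bounds`). Since `R_{n+1} ≥ rmin * R_n`, these windows exhaust all small
scales, and everything is read off from `W_n`.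

The exponent `s` is the one with `E log (N r^s) = 0` (`exists_centring_exponent`). Then `S_n = log
W_n(s)` is a centred i.i.d. walk with almost surely bounded increments, nondegenerate because the
system is not almost deterministic. The strong law gives `S_n / n → 0`, so for `t ≠ s` the drift `(t
- s) ∑ log r_i` decides the limit of `W_n(t)`, and `s` is the dimension
(`hasMinkowskiDim_attractor`). Unboundedness of `S` in both directions gives the lower content `0`
and the upper content `∞`.

The average needs a rate: up to `δ` near `R_n` it is at least a constant times `max_{k ≤ n} W_k(s) /
n`, so it suffices that the running maximum of `exp S` beats every multiple of `n`. This follows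
from an exit estimate for the walk and Borel-Cantelli along dyadic times
(`ae_eventually_exists_mul_le_exp`). -/

/-- The walk with increments `z`, started at `0` and stopped when it leaves `I`. -/
def stoppedWalk (I : Set ℝ) (z : ℕ → ℝ) : ℕ → ℝ
  | 0 => 0
  | n + 1 => stoppedWalk I z n + I.indicator 1 (stoppedWalk I z n) * z n

theorem stoppedWalk_succ_of_mem {I : Set ℝ} {z : ℕ → ℝ} {n : ℕ} (h : stoppedWalk I z n ∈ I) :
    stoppedWalk I z (n + 1) = stoppedWalk I z n + z n := by
  simp [stoppedWalk, h]

theorem stoppedWalk_succ_of_notMem {I : Set ℝ} {z : ℕ → ℝ} {n : ℕ}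
    (h : stoppedWalk I z n ∉ I) : stoppedWalk I z (n + 1) = stoppedWalk I z n := by
  simp [stoppedWalk, h]

theorem stoppedWalk_congr {I : Set ℝ} {z z' : ℕ → ℝ} {n : ℕ} (h : ∀ i < n, z i = z' i) :
    stoppedWalk I z n = stoppedWalk I z' n := by
  induction n with
  | zero => rfl
  | succ n ih =>
    simp only [stoppedWalk]
    rw [ih fun i hi => h i (hi.trans n.lt_succ_self), h n n.lt_succ_self]

theorem measurable_stoppedWalk {I : Set ℝ} (hI : MeasurableSet I) (n : ℕ) :
    Measurable fun z => stoppedWalk I z n := by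
  induction n with
  | zero => exact measurable_const
  | succ n ih =>
    exact ih.add (((measurable_const.indicator hI).comp ih).mul (measurable_pi_apply n))

/-- Here `k` is the minimum of `n` and the exit time from `I`. -/
theorem stoppedWalk_eq_sum (I : Set ℝ) (z : ℕ → ℝ) (n : ℕ) :
    ∃ k ≤ n, stoppedWalk I z n = ∑ i ∈ Finset.range k, z i ∧ (k = n ∨ stoppedWalk I z n ∉ I) := by
  induction n with
  | zero => exact ⟨0, le_rfl, by simp [stoppedWalk], Or.inl rfl⟩
  | succ n ih =>
    obtain ⟨k, hk, hs, h⟩ := ih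
    by_cases hm : stoppedWalk I z n ∈ I
    · obtain rfl : k = n := h.resolve_right (not_not.2 hm)
      exact ⟨k + 1, le_rfl, by rw [stoppedWalk_succ_of_mem hm, hs, Finset.sum_range_succ],
        Or.inl rfl⟩
    · refine ⟨k, hk.trans n.le_succ, ?_, Or.inr ?_⟩ <;> rw [stoppedWalk_succ_of_notMem hm]
      exacts [hs, hm]

theorem stoppedWalk_mem_of_le {I : Set ℝ} {z : ℕ → ℝ} {k n : ℕ} (hkn : k ≤ n)
    (h : stoppedWalk I z n ∈ I) : stoppedWalk I z k ∈ I := by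
  induction n, hkn using Nat.le_induction with
  | base => exact h
  | succ n _ ih =>
    refine ih ?_
    by_contra hm
    exact hm (stoppedWalk_succ_of_notMem hm ▸ h)

/-- The last step starts inside the interval, so it overshoots an end by at most one increment. -/
theorem stoppedWalk_mem_Icc {A B c : ℝ} (hA : 0 ≤ A) (hB : 0 ≤ B) {z : ℕ → ℝ}
    (hz : ∀ i, |z i| ≤ c) (n : ℕ) :
    stoppedWalk (Set.Ioo (-A) B) z n ∈ Set.Icc (-(A + c)) (B + c) := by
  have hc : 0 ≤ c := (abs_nonneg _).trans (hz 0)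
  induction n with
  | zero => constructor <;> simp only [stoppedWalk] <;> linarith
  | succ n ih =>
    by_cases hm : stoppedWalk (Set.Ioo (-A) B) z n ∈ Set.Ioo (-A) B
    · rw [stoppedWalk_succ_of_mem hm]
      have := abs_le.1 (hz n)
      constructor <;> linarith [hm.1, hm.2]
    · rwa [stoppedWalk_succ_of_notMem hm]

section Walk

variable {Ω : Type*} [MeasurableSpace Ω] {μ : Measure Ω} {Z : ℕ → Ω → ℝ} {c v : ℝ}

theorem indepFun_stoppedWalk (hZ : ∀ i, Measurable (Z i)) (hind : ProbabilityTheory.iIndepFun Z μ)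
    {I : Set ℝ} (hI : MeasurableSet I) (n : ℕ) :
    ProbabilityTheory.IndepFun (fun ω => stoppedWalk I (fun i => Z i ω) n) (Z n) μ := by
  have h := hind.indepFun_finset (Finset.range n) {n} (by simp) hZ
  -- Padding by `0` is harmless: the stopped walk at time `n` reads only the increments before `n`.
  let ext : (Finset.range n → ℝ) → ℕ → ℝ := fun x i => if hi : i ∈ Finset.range n then x ⟨i, hi⟩ else 0
  have hext : Measurable ext := by
    refine measurable_pi_lambda _ fun i => ?_
    by_cases hi : i ∈ Finset.range n
    · simpa only [ext, hi, dif_pos] using measurable_pi_apply _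
    · simpa only [ext, hi, dif_neg, not_false_eq_true] using measurable_const
  have h2 := h.comp ((measurable_stoppedWalk hI n).comp hext)
    (measurable_pi_apply (⟨n, Finset.mem_singleton_self n⟩ : ({n} : Finset ℕ)))
  have e : (fun ω => stoppedWalk I (fun i => Z i ω) n) =
      ((fun z => stoppedWalk I z n) ∘ ext) ∘ fun a (i : Finset.range n) => Z i a := by
    funext ω
    refine stoppedWalk_congr fun i hi => ?_
    simp [ext, hi]
  rw [e]
  exact h2

variable [IsProbabilityMeasure μ]

theorem integrable_of_measurable_of_bound {f : Ω → ℝ} (hf : Measurable f) {C : ℝ}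
    (h : ∀ ω, |f ω| ≤ C) : Integrable f μ :=
  Integrable.of_bound hf.aestronglyMeasurable C (ae_of_all _ h)

/-- Optional stopping: each increment is the indicator of not having stopped, times an independent
centred variable. -/
theorem integral_stoppedWalk (hZ : ∀ i, Measurable (Z i))
    (hind : ProbabilityTheory.iIndepFun Z μ) (hc : ∀ i ω, |Z i ω| ≤ c)
    (hmean : ∀ i, ∫ ω, Z i ω ∂μ = 0) {A B : ℝ} (hA : 0 ≤ A) (hB : 0 ≤ B) (n : ℕ) :
    ∫ ω, stoppedWalk (Set.Ioo (-A) B) (fun i => Z i ω) n ∂μ = 0 := by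
  set I := Set.Ioo (-A) B with hI
  have hIm : MeasurableSet I := measurableSet_Ioo
  have hV : ∀ n, Measurable fun ω => stoppedWalk I (fun i => Z i ω) n := fun n =>
    (measurable_stoppedWalk hIm n).comp (measurable_pi_lambda _ hZ)
  have hVi : ∀ n, Integrable (fun ω => stoppedWalk I (fun i => Z i ω) n) μ := fun n =>
    integrable_of_measurable_of_bound (hV n) (C := A + B + c) fun ω => by
      have h := stoppedWalk_mem_Icc hA hB (fun i => hc i ω) n
      exact abs_le.2 ⟨by linarith [h.1], by linarith [h.2]⟩
  have hone : Measurable (I.indicator (1 : ℝ → ℝ)) := measurable_const.indicator hIm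
  have hb : ∀ x, |I.indicator (1 : ℝ → ℝ) x| ≤ 1 := fun x => by
    by_cases hx : x ∈ I <;> simp [hx]
  induction n with
  | zero => simp [stoppedWalk]
  | succ n ih =>
    have h := ((indepFun_stoppedWalk hZ hind hIm n).comp hone measurable_id
      ).integral_fun_mul_eq_mul_integral (hone.comp (hV n)).aestronglyMeasurable
        (hZ n).aestronglyMeasurable
    simp only [Function.comp_apply, id] at h
    simp only [stoppedWalk]
    rw [integral_add (hVi n), ih, h, hmean, mul_zero, zero_add]
    refine integrable_of_measurable_of_bound ((hone.comp (hV n)).mul (hZ n)) (C := 1 * c) fun ω => ?_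
    rw [abs_mul]
    exact mul_le_mul (hb _) (hc n ω) (abs_nonneg _) zero_le_one

/-- Wald's second identity: in the expanded square the cross term has mean zero by independence, and
each step adds `v` times the probability that the walk is still running. -/
theorem integral_stoppedWalk_sq (hZ : ∀ i, Measurable (Z i))
    (hind : ProbabilityTheory.iIndepFun Z μ) (hc : ∀ i ω, |Z i ω| ≤ c)
    (hmean : ∀ i, ∫ ω, Z i ω ∂μ = 0) (hvar : ∀ i, ∫ ω, Z i ω ^ 2 ∂μ = v)
    {A B : ℝ} (hA : 0 ≤ A) (hB : 0 ≤ B) (n : ℕ) :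
    ∫ ω, stoppedWalk (Set.Ioo (-A) B) (fun i => Z i ω) n ^ 2 ∂μ =
      ∑ k ∈ Finset.range n,
        μ.real {ω | stoppedWalk (Set.Ioo (-A) B) (fun i => Z i ω) k ∈ Set.Ioo (-A) B} * v := by
  set I := Set.Ioo (-A) B with hI
  have hIm : MeasurableSet I := measurableSet_Ioo
  have hc0 : 0 ≤ c := (abs_nonneg _).trans (hc 0 (nonempty_of_isProbabilityMeasure μ).some)
  have hV : ∀ n, Measurable fun ω => stoppedWalk I (fun i => Z i ω) n := fun n =>
    (measurable_stoppedWalk hIm n).comp (measurable_pi_lambda _ hZ)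
  have hVb : ∀ n ω, |stoppedWalk I (fun i => Z i ω) n| ≤ A + B + c := fun n ω => by
    have h := stoppedWalk_mem_Icc hA hB (fun i => hc i ω) n
    exact abs_le.2 ⟨by linarith [h.1], by linarith [h.2]⟩
  have hone : Measurable (I.indicator (1 : ℝ → ℝ)) := measurable_const.indicator hIm
  have hb : ∀ x, |I.indicator (1 : ℝ → ℝ) x| ≤ 1 := fun x => by
    by_cases hx : x ∈ I <;> simp [hx]
  induction n with
  | zero => simp [stoppedWalk]
  | succ n ih =>
    have hind' := indepFun_stoppedWalk hZ hind hIm n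
    have hlin : Measurable fun x : ℝ => x * I.indicator (1 : ℝ → ℝ) x := measurable_id.mul hone
    have h1 := (hind'.comp hlin measurable_id
      ).integral_fun_mul_eq_mul_integral (hlin.comp (hV n)).aestronglyMeasurable
        (hZ n).aestronglyMeasurable
    have h2 := (hind'.comp hone (measurable_id.pow_const 2)
      ).integral_fun_mul_eq_mul_integral (hone.comp (hV n)).aestronglyMeasurable
        ((hZ n).pow_const 2).aestronglyMeasurable
    simp only [Function.comp_apply, id] at h1 h2
    rw [hmean, mul_zero] at h1
    rw [hvar] at h2
    have hP : ∫ ω, I.indicator (1 : ℝ → ℝ) (stoppedWalk I (fun i => Z i ω) n) ∂μ =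
        μ.real {ω | stoppedWalk I (fun i => Z i ω) n ∈ I} := by
      exact integral_indicator_one (hV n hIm)
    have e : ∀ ω, stoppedWalk I (fun i => Z i ω) (n + 1) ^ 2 =
        stoppedWalk I (fun i => Z i ω) n ^ 2 +
        2 * (stoppedWalk I (fun i => Z i ω) n *
          I.indicator (1 : ℝ → ℝ) (stoppedWalk I (fun i => Z i ω) n) * Z n ω) +
        I.indicator (1 : ℝ → ℝ) (stoppedWalk I (fun i => Z i ω) n) * Z n ω ^ 2 := by
      intro ω
      by_cases hm : stoppedWalk I (fun i => Z i ω) n ∈ I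
      · rw [stoppedWalk_succ_of_mem hm, Set.indicator_of_mem hm, Pi.one_apply]; ring
      · rw [stoppedWalk_succ_of_notMem hm, Set.indicator_of_notMem hm]; ring
    have hi1 : Integrable (fun ω => stoppedWalk I (fun i => Z i ω) n ^ 2) μ :=
      integrable_of_measurable_of_bound ((hV n).pow_const 2) (C := (A + B + c) ^ 2) fun ω => by
        rw [abs_pow]
        exact pow_le_pow_left₀ (abs_nonneg _) (hVb n ω) 2
    have hi2 : Integrable (fun ω => 2 * (stoppedWalk I (fun i => Z i ω) n *
          I.indicator (1 : ℝ → ℝ) (stoppedWalk I (fun i => Z i ω) n) * Z n ω)) μ :=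
      (integrable_of_measurable_of_bound (((hV n).mul (hone.comp (hV n))).mul (hZ n))
        (C := (A + B + c) * 1 * c) fun ω => by
          simp only [Pi.mul_apply, Function.comp_apply, abs_mul]
          exact mul_le_mul (mul_le_mul (hVb n ω) (hb _) (abs_nonneg _) (by linarith)) (hc n ω)
            (abs_nonneg _) (by linarith)).const_mul 2
    have hi3 : Integrable (fun ω =>
        I.indicator (1 : ℝ → ℝ) (stoppedWalk I (fun i => Z i ω) n) * Z n ω ^ 2) μ :=
      integrable_of_measurable_of_bound ((hone.comp (hV n)).mul ((hZ n).pow_const 2))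
        (C := 1 * c ^ 2) fun ω => by
          rw [abs_mul, abs_pow]
          exact mul_le_mul (hb _) (pow_le_pow_left₀ (abs_nonneg _) (hc n ω) 2) (by positivity)
            zero_le_one
    simp_rw [e]
    have e1 := integral_add (hi1.add hi2) hi3
    simp only [Pi.add_apply] at e1
    rw [e1, integral_add hi1 hi2, integral_const_mul, h1, h2, ih, hP,
      Finset.sum_range_succ]
    ring

/-- A bound for the probability that a walk stays below the level `B` up to time `n`. -/
theorem measure_forall_sum_lt_le (hZ : ∀ i, Measurable (Z i))
    (hind : ProbabilityTheory.iIndepFun Z μ) (hc : ∀ i ω, |Z i ω| ≤ c)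
    (hmean : ∀ i, ∫ ω, Z i ω ∂μ = 0) (hvar : ∀ i, ∫ ω, Z i ω ^ 2 ∂μ = v) (hv : 0 < v)
    {A B : ℝ} (hA : 0 < A) (hB : 0 ≤ B) {n : ℕ} (hn : 0 < n) :
    μ.real {ω | ∀ k ≤ n, ∑ i ∈ Finset.range k, Z i ω < B} ≤
      (A + B + c) ^ 2 / (n * v) + (B + c) / (A + B + c) := by
  set I := Set.Ioo (-A) B with hI
  have hIm : MeasurableSet I := measurableSet_Ioo
  have hc0 : 0 ≤ c := (abs_nonneg _).trans (hc 0 (nonempty_of_isProbabilityMeasure μ).some)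
  have hV : Measurable fun ω => stoppedWalk I (fun i => Z i ω) n :=
    (measurable_stoppedWalk hIm n).comp (measurable_pi_lambda _ hZ)
  have hVm := fun ω => stoppedWalk_mem_Icc hA.le hB (fun i => hc i ω) n
  have hVb : ∀ ω, |stoppedWalk I (fun i => Z i ω) n| ≤ A + B + c := fun ω =>
    abs_le.2 ⟨by linarith [(hVm ω).1], by linarith [(hVm ω).2]⟩
  -- A walk that stays below `B` is, once stopped, either still inside the interval or has left it
  -- at the bottom. The second moment controls the first event, the mean controls the second.
  have hsub : {ω | ∀ k ≤ n, ∑ i ∈ Finset.range k, Z i ω < B} ⊆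
      {ω | stoppedWalk I (fun i => Z i ω) n ∈ I} ∪
        {ω | stoppedWalk I (fun i => Z i ω) n ≤ -A} := by
    intro ω hω
    obtain ⟨k, hk, hs, -⟩ := stoppedWalk_eq_sum I (fun i => Z i ω) n
    have h : stoppedWalk I (fun i => Z i ω) n < B := hs ▸ hω k hk
    rcases le_or_gt (stoppedWalk I (fun i => Z i ω) n) (-A) with h' | h'
    exacts [Or.inr h', Or.inl ⟨h', h⟩]
  refine (measureReal_mono hsub).trans ((measureReal_union_le _ _).trans (add_le_add ?_ ?_))
  · have h1 := integral_stoppedWalk_sq hZ hind hc hmean hvar hA.le hB n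
    have h2 : ∫ ω, stoppedWalk I (fun i => Z i ω) n ^ 2 ∂μ ≤ (A + B + c) ^ 2 := by
      refine (integral_mono_of_nonneg (ae_of_all _ fun ω => sq_nonneg _)
        (integrable_const ((A + B + c) ^ 2)) (ae_of_all _ fun ω => ?_)).trans (by simp)
      exact sq_le_sq' (abs_le.1 (hVb ω)).1 (abs_le.1 (hVb ω)).2
    rw [le_div_iff₀ (by positivity)]
    refine le_trans ?_ (h1.symm.trans_le h2)
    -- Being unstopped at time `n` means being unstopped before, so all `n` terms of Wald's sum are
    -- at least the last probability times `v`.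
    have h3 : ∀ k ∈ Finset.range n, μ.real {ω | stoppedWalk I (fun i => Z i ω) n ∈ I} * v ≤
        μ.real {ω | stoppedWalk I (fun i => Z i ω) k ∈ I} * v := fun k hk =>
      mul_le_mul_of_nonneg_right (measureReal_mono fun ω hω =>
        stoppedWalk_mem_of_le (Finset.mem_range.1 hk).le hω) hv.le
    have h4 := Finset.card_nsmul_le_sum _ _ _ h3
    rw [Finset.card_range, nsmul_eq_mul] at h4
    linarith
  · have hD : 0 < A + B + c := by linarith
    have hS : MeasurableSet {ω | stoppedWalk I (fun i => Z i ω) n ≤ -A} := hV measurableSet_Iic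
    -- This function dominates the stopped walk: it is `B + c` in general and `-A` where the walk
    -- has left at the bottom. Taking means bounds the probability of the latter.
    have hint : Integrable (fun ω => (B + c) - (A + B + c) *
        {ω | stoppedWalk I (fun i => Z i ω) n ≤ -A}.indicator (1 : Ω → ℝ) ω) μ :=
      (integrable_const _).sub (((integrable_const (1 : ℝ)).indicator hS).const_mul _)
    have h := integral_mono (integrable_of_measurable_of_bound hV hVb) hint fun ω => by
      by_cases hω : stoppedWalk I (fun i => Z i ω) n ≤ -A
      · simp only [Set.indicator, Set.mem_ofPred_eq, hω, if_true, Pi.one_apply]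
        linarith
      · simp only [Set.indicator, Set.mem_ofPred_eq, hω, if_false]
        linarith [(hVm ω).2]
    have e1 := integral_sub (integrable_const (μ := μ) (B + c))
      (((integrable_const (μ := μ) (1 : ℝ)).indicator hS).const_mul (A + B + c))
    have e2 : ∫ ω, {ω | stoppedWalk I (fun i => Z i ω) n ≤ -A}.indicator (fun _ => (1 : ℝ)) ω ∂μ =
        μ.real {ω | stoppedWalk I (fun i => Z i ω) n ≤ -A} := integral_indicator_one hS
    rw [integral_const_mul, e2] at e1
    simp only [integral_const, probReal_univ, one_smul] at e1
    have h' := (integral_stoppedWalk hZ hind hc hmean hA.le hB n).symm.trans_le (h.trans_eq e1)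
    rw [le_div_iff₀ hD]
    linarith

/-- Along dyadic times, a centred walk with bounded increments eventually exceeds every multiple of
the logarithm of the time. -/
theorem ae_eventually_exists_le_sum (hZ : ∀ i, Measurable (Z i))
    (hind : ProbabilityTheory.iIndepFun Z μ) (hc : ∀ i ω, |Z i ω| ≤ c)
    (hmean : ∀ i, ∫ ω, Z i ω ∂μ = 0) (hvar : ∀ i, ∫ ω, Z i ω ^ 2 ∂μ = v) (hv : 0 < v)
    {κ : ℝ} (hκ : 0 ≤ κ) :
    ∀ᵐ ω ∂μ, ∀ᶠ j : ℕ in atTop, ∃ k ≤ 2 ^ j, κ * j ≤ ∑ i ∈ Finset.range k, Z i ω := by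
  have hc0 : 0 ≤ c := (abs_nonneg _).trans (hc 0 (nonempty_of_isProbabilityMeasure μ).some)
  set K := 1 + κ + c with hK
  have hsum : Summable fun j : ℕ => K ^ 2 / v * ((j : ℝ) ^ 6 * (1 / 2) ^ j) +
      K * (1 / (j : ℝ) ^ 2) := by
    refine (Summable.mul_left _ ?_).add (Summable.mul_left _ ?_)
    · exact summable_pow_mul_geometric_of_norm_lt_one 6 (by norm_num)
    · exact Real.summable_one_div_nat_pow.2 one_lt_two
  have hbound : ∀ j : ℕ, 1 ≤ j →
      μ.real {ω | ∀ k ≤ 2 ^ j, ∑ i ∈ Finset.range k, Z i ω < κ * j} ≤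
        K ^ 2 / v * ((j : ℝ) ^ 6 * (1 / 2) ^ j) + K * (1 / (j : ℝ) ^ 2) := by
    intro j hj
    have hj' : (1 : ℝ) ≤ j := by exact_mod_cast hj
    -- The depth `j ^ 3` makes both error terms summable: about `j ^ 6 / 2 ^ j` for not leaving in
    -- time and `j / j ^ 3` for leaving at the bottom.
    have h := measure_forall_sum_lt_le hZ hind hc hmean hvar hv (A := (j : ℝ) ^ 3) (B := κ * j)
      (by positivity) (by positivity) (n := 2 ^ j) (by positivity)
    refine h.trans (add_le_add ?_ ?_)
    · have h1 : (j : ℝ) ^ 3 + κ * j + c ≤ K * (j : ℝ) ^ 3 := by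
        have e1 : (j : ℝ) ≤ (j : ℝ) ^ 3 := le_self_pow₀ hj' (by norm_num)
        have e2 : (1 : ℝ) ≤ (j : ℝ) ^ 3 := one_le_pow₀ hj'
        nlinarith [mul_le_mul_of_nonneg_left e1 hκ, mul_le_mul_of_nonneg_left e2 hc0]
      calc ((j : ℝ) ^ 3 + κ * j + c) ^ 2 / (((2 ^ j : ℕ) : ℝ) * v)
          ≤ (K * (j : ℝ) ^ 3) ^ 2 / (((2 ^ j : ℕ) : ℝ) * v) := by gcongr
        _ = _ := by
          push_cast
          rw [one_div, inv_pow]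
          field_simp
    · have h1 : κ * j + c ≤ K * j := by nlinarith
      have h2 : (j : ℝ) ^ 3 ≤ (j : ℝ) ^ 3 + κ * j + c := by
        have : 0 ≤ κ * j := by positivity
        linarith
      calc (κ * j + c) / ((j : ℝ) ^ 3 + κ * j + c) ≤ (K * j) / (j : ℝ) ^ 3 := by gcongr
        _ = _ := by field_simp
  have hfin : ∑' j : ℕ, μ {ω | 1 ≤ j ∧ ∀ k ≤ 2 ^ j, ∑ i ∈ Finset.range k, Z i ω < κ * j} ≠ ∞ := by
    refine ne_top_of_le_ne_top hsum.tsum_ofReal_ne_top (ENNReal.tsum_le_tsum fun j => ?_)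
    rcases Nat.eq_zero_or_pos j with rfl | hj
    · simp
    · have hsub : {ω | 1 ≤ j ∧ ∀ k ≤ 2 ^ j, ∑ i ∈ Finset.range k, Z i ω < κ * j} ⊆
          {ω | ∀ k ≤ 2 ^ j, ∑ i ∈ Finset.range k, Z i ω < κ * j} := fun ω hω => hω.2
      rw [← ofReal_measureReal]
      exact ENNReal.ofReal_le_ofReal ((measureReal_mono hsub).trans (hbound j hj))
  filter_upwards [ae_eventually_notMem hfin] with ω hω
  filter_upwards [hω, eventually_ge_atTop 1] with j hj hj1
  by_contra hcon
  push Not at hcon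
  exact hj ⟨hj1, hcon⟩

/-- The exponential of a centred, bounded, nondegenerate walk has running maxima that grow faster
than linearly. -/
theorem ae_eventually_exists_mul_le_exp (hZ : ∀ i, Measurable (Z i))
    (hind : ProbabilityTheory.iIndepFun Z μ) (hc : ∀ i ω, |Z i ω| ≤ c)
    (hmean : ∀ i, ∫ ω, Z i ω ∂μ = 0) (hvar : ∀ i, ∫ ω, Z i ω ^ 2 ∂μ = v) (hv : 0 < v) :
    ∀ᵐ ω ∂μ, ∀ (M : ℝ) (m : ℕ), ∀ᶠ n : ℕ in atTop, ∃ k, m ≤ k ∧ k ≤ n ∧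
      M * n ≤ Real.exp (∑ i ∈ Finset.range k, Z i ω) := by
  -- The rate `κ = 2` suffices because `exp (2 j) ≥ 2 ^ j * 2 ^ j`: for `n ≤ 2 * 2 ^ j` one factor
  -- handles `n` and the other absorbs `2 |M|`.
  filter_upwards [ae_eventually_exists_le_sum hZ hind hc hmean hvar hv zero_le_two] with ω hω
  have key : ∀ M : ℝ, ∀ᶠ n : ℕ in atTop, ∃ k ≤ n,
      M * n ≤ Real.exp (∑ i ∈ Finset.range k, Z i ω) := by
    intro M
    have hpow : Tendsto (fun j : ℕ => (2 : ℝ) ^ j) atTop atTop :=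
      tendsto_pow_atTop_atTop_of_one_lt one_lt_two
    have hlog : Tendsto (fun n : ℕ => Nat.log 2 n) atTop atTop :=
      tendsto_atTop.2 fun j => by
        filter_upwards [eventually_ge_atTop (2 ^ j)] with n hn
        exact Nat.le_log_of_pow_le one_lt_two hn
    filter_upwards [hlog.eventually hω, hlog.eventually (hpow.eventually_ge_atTop (2 * |M|)),
      eventually_ne_atTop 0] with n hn hM hn0
    obtain ⟨k, hk, hS⟩ := hn
    set j := Nat.log 2 n
    refine ⟨k, hk.trans (Nat.pow_log_le_self 2 hn0), ?_⟩
    have h1 : (n : ℝ) ≤ 2 ^ j * 2 := by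
      have := (Nat.lt_pow_succ_log_self one_lt_two n).le
      rw [pow_succ] at this
      exact_mod_cast this
    have h2 : (2 : ℝ) ≤ Real.exp 1 := by linarith [Real.add_one_le_exp (1 : ℝ)]
    calc M * n ≤ |M| * (2 ^ j * 2) :=
          mul_le_mul (le_abs_self M) h1 (Nat.cast_nonneg n) (abs_nonneg M)
      _ = 2 ^ j * (2 * |M|) := by ring
      _ ≤ 2 ^ j * 2 ^ j := by gcongr
      _ ≤ Real.exp 1 ^ j * Real.exp 1 ^ j := by gcongr
      _ = Real.exp (2 * j) := by rw [← Real.exp_nat_mul, ← Real.exp_add]; ring_nf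
      _ ≤ _ := Real.exp_le_exp.2 hS
  intro M m
  have hlin : Tendsto (fun n : ℕ => (n : ℝ)) atTop atTop := tendsto_natCast_atTop_atTop
  -- Once `n` exceeds the sum of the first `m` exponentials, no index below `m` can be the one where
  -- the value is at least `n`.
  filter_upwards [key (max M 1), hlin.eventually_gt_atTop
    (∑ k ∈ Finset.range m, Real.exp (∑ i ∈ Finset.range k, Z i ω))] with n hn hbig
  obtain ⟨k, hk, hS⟩ := hn
  refine ⟨k, ?_, hk, le_trans (by gcongr; exact le_max_left _ _) hS⟩
  by_contra hkm
  have h1 := Finset.single_le_sum (f := fun k => Real.exp (∑ i ∈ Finset.range k, Z i ω))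
    (fun _ _ => (Real.exp_pos _).le) (Finset.mem_range.2 (not_le.1 hkm))
  have h2 : (n : ℝ) ≤ max M 1 * n := le_mul_of_one_le_left (Nat.cast_nonneg n) (le_max_right _ _)
  linarith

end Walk

variable {d : ℕ} {rmin rmax : ℝ}

/-! ### Cylinders -/

theorem Sim.dist_map (f : Sim d rmin rmax) (x y : E d) :
    dist (f.map x) (f.map y) = f.ratio * dist x y :=
  Dilation.dist_eq f.1 x y

theorem Sim.norm_map_le_one (f : Sim d rmin rmax) {x : E d} (hx : ‖x‖ ≤ 1) : ‖f.map x‖ ≤ 1 := by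
  have h := f.2.2 ⟨x, mem_closedBall_zero_iff.2 hx, rfl⟩
  exact mem_closedBall_zero_iff.1 h

theorem Sim.ratio_pos (f : Sim d rmin rmax) : 0 < f.ratio :=
  NNReal.coe_pos.2 (Dilation.ratio_pos f.1)

theorem Tuple.N_pos (l : Tuple d rmin rmax) : 0 < l.N := l.1.pos

variable {ω : ℕ → Tuple d rmin rmax}

theorem cylinderMap_congr {v w : Coding ω} {n : ℕ} (h : ∀ i < n, v i = w i) :
    cylinderMap ω v n = cylinderMap ω w n := by
  induction n with
  | zero => rfl
  | succ n ih =>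
    simp only [cylinderMap]
    rw [ih fun i hi => h i (hi.trans n.lt_succ_self), h n n.lt_succ_self]

theorem cylinderRatio_nonneg (v : Coding ω) (n : ℕ) : 0 ≤ cylinderRatio ω v n :=
  Finset.prod_nonneg fun _ _ => (Sim.ratio_pos _).le

theorem dist_cylinderMap (v : Coding ω) (n : ℕ) (x y : E d) :
    dist (cylinderMap ω v n x) (cylinderMap ω v n y) = cylinderRatio ω v n * dist x y := by
  induction n generalizing x y with
  | zero => simp [cylinderMap, cylinderRatio]
  | succ n ih =>
    simp only [cylinderMap, Function.comp_apply, Tuple.map]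
    rw [ih, Sim.dist_map, cylinderRatio, cylinderRatio, Finset.prod_range_succ, mul_assoc]
    rfl

/-- The inner `k` maps keep the point in the unit ball, so only the first `n` maps matter. -/
theorem dist_cylinderMap_add_le (v : Coding ω) (n k : ℕ) {x : E d} (hx : ‖x‖ ≤ 1) :
    dist (cylinderMap ω v (n + k) x) (cylinderMap ω v n 0) ≤ cylinderRatio ω v n := by
  induction k generalizing x with
  | zero =>
    rw [add_zero, dist_cylinderMap, dist_zero_right]
    exact mul_le_of_le_one_right (cylinderRatio_nonneg v n) hx
  | succ k ih => exact ih (Sim.norm_map_le_one _ hx)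

theorem dist_le_of_tendsto_cylinderMap {v : Coding ω} {x : E d}
    (h : Tendsto (fun n => cylinderMap ω v n 0) atTop (𝓝 x)) (n : ℕ) :
    dist x (cylinderMap ω v n 0) ≤ cylinderRatio ω v n := by
  refine le_of_tendsto (h.dist tendsto_const_nhds) ?_
  filter_upwards [eventually_ge_atTop n] with m hm
  obtain ⟨k, rfl⟩ := Nat.exists_eq_add_of_le hm
  exact dist_cylinderMap_add_le v n k (by simp)

theorem cylinderRatio_le_pow (v : Coding ω) (n : ℕ) : cylinderRatio ω v n ≤ rmax ^ n := by
  rw [← Finset.card_range n, ← Finset.prod_const, Finset.card_range]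
  exact Finset.prod_le_prod (fun i _ => (Sim.ratio_pos _).le) fun i _ => ((ω i).2 (v i)).2.1.2

theorem exists_tendsto_cylinderMap (hrmax : rmax < 1) (v : Coding ω) :
    ∃ x, Tendsto (fun n => cylinderMap ω v n 0) atTop (𝓝 x) := by
  have h0 : 0 ≤ rmax := (Sim.ratio_pos ((ω 0).2 (v 0))).le.trans ((ω 0).2 (v 0)).2.1.2
  refine cauchySeq_tendsto_of_complete (cauchySeq_of_le_tendsto_0' (fun n => rmax ^ n) ?_
    (tendsto_pow_atTop_nhds_zero_of_lt_one h0 hrmax))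
  intro n m hnm
  obtain ⟨k, rfl⟩ := Nat.exists_eq_add_of_le hnm
  rw [dist_comm]
  exact (dist_cylinderMap_add_le v n k (by simp)).trans (cylinderRatio_le_pow v n)

/-- The words of length `n`. -/
abbrev Word (ω : ℕ → Tuple d rmin rmax) (n : ℕ) : Type := (i : Fin n) → Fin (ω i).N

/-- A coding that starts with the given word. -/
def Word.extend {n : ℕ} (w : Word ω n) : Coding ω := fun i =>
  if h : i < n then w ⟨i, h⟩ else ⟨0, (ω i).N_pos⟩

theorem Word.extend_apply {n : ℕ} (w : Word ω n) (i : Fin n) : w.extend i = w i := by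
  simp [Word.extend]

theorem Word.card (n : ℕ) : Fintype.card (Word ω n) = ∏ i ∈ Finset.range n, (ω i).N := by
  rw [Fintype.card_pi]
  simp only [Fintype.card_fin]
  exact Fin.prod_univ_eq_prod_range (fun i => (ω i).N) n

/-! ### Volumes of neighbourhoods of the attractor -/

/-- Each level-`n` cylinder lies within the common ratio of the image of `0`, so one ball per word
covers the neighbourhood. -/
theorem volume_cthickening_attractor_le {r : ℕ → ℝ} (hr : ∀ i j, (ω i).ratio j = r i) (n : ℕ)
    {ε : ℝ} (hε : 0 < ε) :
    volume (Metric.cthickening ε (attractor ω)) ≤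
      ((∏ i ∈ Finset.range n, (ω i).N : ℕ) : ℝ≥0∞) *
        (ENNReal.ofReal ((∏ i ∈ Finset.range n, r i + 2 * ε) ^ d) *
          volume (Metric.ball (0 : E d) 1)) := by
  have hR : ∀ v, cylinderRatio ω v n = ∏ i ∈ Finset.range n, r i := fun v =>
    Finset.prod_congr rfl fun i _ => hr i (v i)
  set R := ∏ i ∈ Finset.range n, r i
  have hR0 : 0 ≤ R := by
    rw [← hR fun i => ⟨0, (ω i).N_pos⟩]
    exact cylinderRatio_nonneg _ n
  have hsub : Metric.cthickening ε (attractor ω) ⊆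
      ⋃ w : Word ω n, Metric.closedBall (cylinderMap ω w.extend n 0) (R + 2 * ε) := by
    intro y hy
    -- Passing to the open neighbourhood of twice the radius yields an actual nearby point of the
    -- attractor without using compactness.
    have hy' := Metric.cthickening_subset_thickening' (by linarith : 0 < 2 * ε)
      (by linarith : ε < 2 * ε) _ hy
    obtain ⟨x, ⟨v, hv⟩, hyx⟩ := Metric.mem_thickening_iff.1 hy'
    refine Set.mem_iUnion.2 ⟨fun i => v i, ?_⟩
    rw [cylinderMap_congr (w := v) fun i hi => Word.extend_apply (n := n) (fun i => v i) ⟨i, hi⟩]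
    have h1 := dist_le_of_tendsto_cylinderMap hv n
    rw [hR] at h1
    rw [Metric.mem_closedBall]
    linarith [dist_triangle y x (cylinderMap ω v n 0)]
  refine (measure_mono hsub).trans ((measure_iUnion_le _).trans ?_)
  have hb : ∀ w : Word ω n, volume (Metric.closedBall (cylinderMap ω w.extend n 0) (R + 2 * ε)) =
      ENNReal.ofReal ((R + 2 * ε) ^ d) * volume (Metric.ball (0 : E d) 1) := fun w => by
    rw [Measure.addHaar_closedBall _ _ (by linarith), finrank_euclideanSpace_fin]
  rw [tsum_fintype, Finset.sum_congr rfl fun w _ => hb w, Finset.sum_const, Finset.card_univ,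
    Word.card, nsmul_eq_mul]

/-- Separation makes the balls of radius `γ / 2` times the ratio around the images of `x₀` disjoint.
The constant adds this radius, the distance `‖x₀‖` from `x₀` to `0`, and the distance `1` from the
image of `0` to the attractor, all in units of the ratio. -/
theorem le_volume_cthickening_attractor (hrmax : rmax < 1) {r : ℕ → ℝ}
    (hr : ∀ i j, (ω i).ratio j = r i) {γ : ℝ} (hγ : 0 < γ) {x₀ : E d}
    (hsep : ∀ v w : Coding ω, ∀ n m : ℕ, 1 ≤ n → 1 ≤ m → ¬ (n = m ∧ ∀ i < n, v i = w i) →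
      γ * min (cylinderRatio ω v n) (cylinderRatio ω w m) ≤
        ‖cylinderMap ω v n x₀ - cylinderMap ω w m x₀‖) {n : ℕ} (hn : 1 ≤ n)
    {ε : ℝ} (hε : (γ / 2 + 1 + ‖x₀‖) * ∏ i ∈ Finset.range n, r i ≤ ε) :
    ((∏ i ∈ Finset.range n, (ω i).N : ℕ) : ℝ≥0∞) *
        (ENNReal.ofReal ((γ / 2 * ∏ i ∈ Finset.range n, r i) ^ d) *
          volume (Metric.ball (0 : E d) 1)) ≤
      volume (Metric.cthickening ε (attractor ω)) := by
  have hR : ∀ v, cylinderRatio ω v n = ∏ i ∈ Finset.range n, r i := fun v =>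
    Finset.prod_congr rfl fun i _ => hr i (v i)
  set R := ∏ i ∈ Finset.range n, r i
  have hR0 : 0 < R := by
    rw [← hR fun i => ⟨0, (ω i).N_pos⟩]
    exact Finset.prod_pos fun i _ => Sim.ratio_pos _
  have hsub : (⋃ w : Word ω n, Metric.ball (cylinderMap ω w.extend n x₀) (γ / 2 * R)) ⊆
      Metric.cthickening ε (attractor ω) := by
    refine Set.iUnion_subset fun w y hy => ?_
    obtain ⟨x, hx⟩ := exists_tendsto_cylinderMap hrmax w.extend
    refine Metric.mem_cthickening_of_dist_le y x ε _ ⟨w.extend, hx⟩ ?_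
    have h1 := dist_le_of_tendsto_cylinderMap hx n
    have h2 := dist_cylinderMap w.extend n x₀ 0
    rw [hR, dist_zero_right] at h2
    rw [hR] at h1
    rw [Metric.mem_ball] at hy
    have h3 := dist_triangle y (cylinderMap ω w.extend n x₀) x
    have h4 := dist_triangle (cylinderMap ω w.extend n x₀) (cylinderMap ω w.extend n 0) x
    rw [dist_comm (cylinderMap ω w.extend n 0) x] at h4
    linarith
  have hdisj : Pairwise (Function.onFun Disjoint fun w : Word ω n =>
      Metric.ball (cylinderMap ω w.extend n x₀) (γ / 2 * R)) := by
    intro w w' hne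
    refine Metric.ball_disjoint_ball ?_
    have h := hsep w.extend w'.extend n n hn hn fun h => hne <| funext fun i => by
      rw [← Word.extend_apply w, ← Word.extend_apply w']
      exact h.2 i i.2
    rw [hR, hR, min_self, ← dist_eq_norm] at h
    linarith
  refine le_trans ?_ (measure_mono hsub)
  have hb : ∀ w : Word ω n, volume (Metric.ball (cylinderMap ω w.extend n x₀) (γ / 2 * R)) =
      ENNReal.ofReal ((γ / 2 * R) ^ d) * volume (Metric.ball (0 : E d) 1) := fun w => by
    rw [Measure.addHaar_ball_of_pos _ _ (by positivity), finrank_euclideanSpace_fin]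
  rw [measure_iUnion hdisj fun w => measurableSet_ball, tsum_fintype,
    Finset.sum_congr rfl fun w _ => hb w, Finset.sum_const, Finset.card_univ,
    Word.card, nsmul_eq_mul]

/-- The sign of `p` is not fixed, so either endpoint may give the extremum. -/
theorem exists_forall_rpow_mem_Icc {a b : ℝ} (ha : 0 < a) (p : ℝ) :
    ∃ m M : ℝ, 0 < m ∧ 0 < M ∧ ∀ u ∈ Set.Icc a b, m ≤ u ^ p ∧ u ^ p ≤ M := by
  rcases le_or_gt a b with hab | hab
  · have hb := ha.trans_le hab
    refine ⟨min (a ^ p) (b ^ p), max (a ^ p) (b ^ p), lt_min (by positivity) (by positivity),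
      lt_max_of_lt_left (by positivity), fun u hu => ?_⟩
    have hu0 := ha.trans_le hu.1
    rcases le_total 0 p with hp | hp
    · exact ⟨min_le_of_left_le (Real.rpow_le_rpow ha.le hu.1 hp),
        le_max_of_le_right (Real.rpow_le_rpow hu0.le hu.2 hp)⟩
    · exact ⟨min_le_of_right_le (Real.rpow_le_rpow_of_nonpos hu0 hu.2 hp),
        le_max_of_le_left (Real.rpow_le_rpow_of_nonpos ha hu.1 hp)⟩
  · exact ⟨1, 1, one_pos, one_pos, fun u hu => absurd (hu.1.trans hu.2) (not_le.2 hab)⟩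

theorem rpow_sub_natCast_mul_pow {x : ℝ} (hx : 0 < x) (t : ℝ) (d : ℕ) :
    x ^ (t - d) * x ^ d = x ^ t := by
  rw [Real.rpow_sub hx, Real.rpow_natCast]
  field_simp

/-- At scales comparable to the `n`-th contraction ratio, the scaled volume of an equicontractive
separated attractor is comparable to the `n`-th partition sum. -/
theorem exists_scaledVolume_bounds (hrmax : rmax < 1) {r : ℕ → ℝ}
    (hr : ∀ i j, (ω i).ratio j = r i) {γ : ℝ} (hγ : 0 < γ) {x₀ : E d}
    (hsep : ∀ v w : Coding ω, ∀ n m : ℕ, 1 ≤ n → 1 ≤ m → ¬ (n = m ∧ ∀ i < n, v i = w i) →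
      γ * min (cylinderRatio ω v n) (cylinderRatio ω w m) ≤
        ‖cylinderMap ω v n x₀ - cylinderMap ω w m x₀‖) (b t : ℝ) :
    ∃ c C : ℝ, 0 < c ∧ 0 < C ∧ ∀ n, 1 ≤ n →
      ∀ ε ∈ Set.Icc ((γ / 2 + 1 + ‖x₀‖) * ∏ i ∈ Finset.range n, r i)
        (b * ∏ i ∈ Finset.range n, r i),
      ENNReal.ofReal (c * ∏ i ∈ Finset.range n, ((ω i).N * r i ^ t)) ≤
        scaledVolume t (attractor ω) ε ∧
      scaledVolume t (attractor ω) ε ≤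
        ENNReal.ofReal (C * ∏ i ∈ Finset.range n, ((ω i).N * r i ^ t)) := by
  set a := γ / 2 + 1 + ‖x₀‖ with ha
  have ha0 : 0 < a := by positivity
  obtain ⟨m, M, hm, hM, hmM⟩ := exists_forall_rpow_mem_Icc (b := max a b) ha0 (t - d)
  set κ := (volume (Metric.ball (0 : E d) 1)).toReal with hκ
  have hvol : volume (Metric.ball (0 : E d) 1) = ENNReal.ofReal κ :=
    (ENNReal.ofReal_toReal measure_ball_lt_top.ne).symm
  have hκ0 : 0 < κ := ENNReal.toReal_pos (Metric.measure_ball_pos _ _ one_pos).ne'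
    measure_ball_lt_top.ne
  have hb0 : 0 < max a b := lt_max_of_lt_left ha0
  refine ⟨m * (γ / 2) ^ d * κ, M * (1 + 2 * max a b) ^ d * κ, by positivity, by positivity,
    fun n hn ε hε => ?_⟩
  have hr0 : ∀ i, 0 < r i := fun i => by
    rw [← hr i ⟨0, (ω i).N_pos⟩]
    exact Sim.ratio_pos _
  have hprod : ∏ i ∈ Finset.range n, ((ω i).N * r i ^ t) =
      ((∏ i ∈ Finset.range n, (ω i).N : ℕ) : ℝ) * (∏ i ∈ Finset.range n, r i) ^ t := by
    rw [Finset.prod_mul_distrib, Nat.cast_prod, Real.finsetProd_rpow _ _ fun i _ => (hr0 i).le]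
  rw [hprod]
  set R := ∏ i ∈ Finset.range n, r i with hRdef
  have hR0 : 0 < R := Finset.prod_pos fun i _ => hr0 i
  set P := ∏ i ∈ Finset.range n, (ω i).N
  -- In units of `R` the scale ranges over a fixed compact interval, so `u ^ (t - d)` only costs
  -- constants, and `R ^ (t - d)` combines with the volume factor `R ^ d` to `R ^ t`.
  obtain ⟨u, rfl⟩ : ∃ u, ε = u * R := ⟨ε / R, by field_simp⟩
  have hu1 : a ≤ u := le_of_mul_le_mul_right hε.1 hR0
  have hu2 : u ≤ b := le_of_mul_le_mul_right hε.2 hR0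
  have hu0 := ha0.trans_le hu1
  have hum := hmM u ⟨hu1, hu2.trans (le_max_right _ _)⟩
  have hP : (P : ℝ≥0∞) = ENNReal.ofReal (P : ℝ) := by simp
  have hRR := rpow_sub_natCast_mul_pow hR0 t d
  have hRt : 0 < R ^ (t - d) := by positivity
  constructor
  · have h := le_volume_cthickening_attractor hrmax hr hγ hsep hn (ε := u * R) hε.1
    refine le_trans ?_ (mul_le_mul_right h _)
    rw [hvol, ← hRdef, hP, ← ENNReal.ofReal_mul (by positivity),
      ← ENNReal.ofReal_mul (by positivity), ← ENNReal.ofReal_mul (by positivity)]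
    refine ENNReal.ofReal_le_ofReal ?_
    rw [Real.mul_rpow hu0.le hR0.le, ← hRR, mul_pow]
    calc m * (γ / 2) ^ d * κ * (P * (R ^ (t - d) * R ^ d))
        = m * (R ^ (t - d) * (P * ((γ / 2) ^ d * R ^ d * κ))) := by ring
      _ ≤ u ^ (t - d) * (R ^ (t - d) * (P * ((γ / 2) ^ d * R ^ d * κ))) :=
        mul_le_mul_of_nonneg_right hum.1 (by positivity)
      _ = _ := by ring
  · have h := volume_cthickening_attractor_le (ω := ω) hr n (ε := u * R) (by positivity)
    refine (mul_le_mul_right h _).trans ?_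
    rw [hvol, ← hRdef, hP, ← ENNReal.ofReal_mul (by positivity),
      ← ENNReal.ofReal_mul (by positivity), ← ENNReal.ofReal_mul (by positivity)]
    refine ENNReal.ofReal_le_ofReal ?_
    rw [Real.mul_rpow hu0.le hR0.le, ← hRR, show R + 2 * (u * R) = (1 + 2 * u) * R by ring,
      mul_pow]
    calc u ^ (t - d) * R ^ (t - d) * (P * ((1 + 2 * u) ^ d * R ^ d * κ))
        ≤ M * R ^ (t - d) * (P * ((1 + 2 * max a b) ^ d * R ^ d * κ)) := by
          have h1 := hum.2
          have h2 := hu2.trans (le_max_right a b)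
          gcongr
      _ = _ := by ring

/-! ### From scales to neighbourhoods of zero -/

section Scales

variable {R : ℕ → ℝ} {a b q : ℝ}

/-- The intervals between consecutive scales cover a right neighbourhood of zero: take the first `n`
with `a * R n ≤ ε`. -/
theorem eventually_nhdsGT_zero_of_scales (ha : 0 < a) (hR : ∀ n, 0 < R n) (hanti : Antitone R)
    (hlim : Tendsto R atTop (𝓝 0)) {p : ℝ → Prop}
    (h : ∀ᶠ n in atTop, ∀ ε ∈ Set.Icc (a * R (n + 1)) (a * R n), p ε) :
    ∀ᶠ ε in 𝓝[>] (0 : ℝ), p ε := by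
  obtain ⟨m, hm⟩ := eventually_atTop.1 h
  have hlim' : Tendsto (fun n => a * R n) atTop (𝓝 0) := by simpa using hlim.const_mul a
  filter_upwards [Ioo_mem_nhdsGT (mul_pos ha (hR m))] with ε hε
  have hex : ∃ n, a * R n ≤ ε := ((hlim'.eventually_lt_const hε.1).exists).imp fun _ h => h.le
  obtain ⟨n, hn, hmin⟩ : ∃ n, a * R n ≤ ε ∧ ∀ k < n, ¬ a * R k ≤ ε := by
    classical
    exact ⟨Nat.find hex, Nat.find_spec hex, fun k hk => Nat.find_min hex hk⟩
  have hmn : m < n := by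
    by_contra hcon
    have := mul_le_mul_of_nonneg_left (hanti (not_lt.1 hcon)) ha.le
    linarith [hε.2]
  obtain ⟨k, rfl⟩ : ∃ k, n = k + 1 := ⟨n - 1, by omega⟩
  exact hm k (by omega) ε ⟨hn, (not_le.1 (hmin k k.lt_succ_self)).le⟩

theorem eventually_nhdsGT_zero_of_comparable_scales (ha : 0 < a) (hR : ∀ n, 0 < R n)
    (hanti : Antitone R) (hlim : Tendsto R atTop (𝓝 0)) (hq : 0 < q)
    (hqR : ∀ n, q * R n ≤ R (n + 1)) {p : ℝ → Prop}
    (h : ∀ᶠ n in atTop, ∀ ε ∈ Set.Icc (a * R n) (a / q * R n), p ε) :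
    ∀ᶠ ε in 𝓝[>] (0 : ℝ), p ε := by
  refine eventually_nhdsGT_zero_of_scales ha hR hanti hlim ?_
  -- The interval from `a * R (n + 1)` to `a * R n` lies in the window of index `n + 1`, as `R n ≤ R
  -- (n + 1) / q`.
  filter_upwards [(tendsto_add_atTop_nat 1).eventually h] with n hn ε hε
  refine hn ε ⟨hε.1, hε.2.trans ?_⟩
  rw [div_mul_eq_mul_div, le_div_iff₀ hq]
  nlinarith [hqR n]

variable {g : ℝ → ℝ≥0∞} {W : ℕ → ℝ} {c C : ℝ}

theorem tendsto_top_of_scales (ha : 0 < a) (hR : ∀ n, 0 < R n)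
    (hanti : Antitone R) (hlim : Tendsto R atTop (𝓝 0)) (hq : 0 < q)
    (hqR : ∀ n, q * R n ≤ R (n + 1)) (hc : 0 < c)
    (hg : ∀ n, 1 ≤ n → ∀ ε ∈ Set.Icc (a * R n) (a / q * R n), ENNReal.ofReal (c * W n) ≤ g ε)
    (hW : Tendsto W atTop atTop) : Tendsto g (𝓝[>] 0) (𝓝 ∞) := by
  refine ENNReal.tendsto_nhds_top_iff_nnreal.2 fun x =>
    eventually_nhdsGT_zero_of_comparable_scales ha hR hanti hlim hq hqR ?_
  filter_upwards [(hW.const_mul_atTop hc).eventually_gt_atTop (x : ℝ), eventually_ge_atTop 1]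
    with n hn hn1 ε hε
  refine lt_of_lt_of_le ?_ (hg n hn1 ε hε)
  rw [← ENNReal.ofReal_coe_nnreal]
  exact ENNReal.ofReal_lt_ofReal_iff'.2 ⟨hn, x.2.trans_lt hn⟩

theorem tendsto_zero_of_scales (ha : 0 < a) (hR : ∀ n, 0 < R n)
    (hanti : Antitone R) (hlim : Tendsto R atTop (𝓝 0)) (hq : 0 < q)
    (hqR : ∀ n, q * R n ≤ R (n + 1))
    (hg : ∀ n, 1 ≤ n → ∀ ε ∈ Set.Icc (a * R n) (a / q * R n), g ε ≤ ENNReal.ofReal (C * W n))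
    (hW : Tendsto W atTop (𝓝 0)) : Tendsto g (𝓝[>] 0) (𝓝 0) := by
  refine ENNReal.tendsto_nhds_zero.2 fun x hx =>
    eventually_nhdsGT_zero_of_comparable_scales ha hR hanti hlim hq hqR ?_
  have hW' : Tendsto (fun n => ENNReal.ofReal (C * W n)) atTop (𝓝 0) := by
    simpa using ENNReal.tendsto_ofReal (hW.const_mul C)
  filter_upwards [ENNReal.tendsto_nhds_zero.1 hW' x hx, eventually_ge_atTop 1] with n hn hn1 ε hε
  exact (hg n hn1 ε hε).trans hn

theorem tendsto_const_mul_scales (ha : 0 < a) (hR : ∀ n, 0 < R n)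
    (hlim : Tendsto R atTop (𝓝 0)) : Tendsto (fun n => a * R n) atTop (𝓝[>] 0) :=
  tendsto_nhdsWithin_iff.2 ⟨by simpa using hlim.const_mul a,
    Eventually.of_forall fun n => mul_pos ha (hR n)⟩

theorem liminf_eq_zero_of_scales (ha : 0 < a) (hR : ∀ n, 0 < R n)
    (hlim : Tendsto R atTop (𝓝 0)) (hC : 0 < C)
    (hg : ∀ n, 1 ≤ n → g (a * R n) ≤ ENNReal.ofReal (C * W n))
    (hW : ∀ η : ℝ, 0 < η → ∃ᶠ n in atTop, W n ≤ η) : liminf g (𝓝[>] 0) = 0 := by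
  refine le_antisymm (le_of_forall_gt_imp_ge_of_dense fun x hx => ?_) bot_le
  refine liminf_le_of_frequently_le' ((tendsto_const_mul_scales ha hR hlim).frequently ?_)
  obtain ⟨y, hy0, hyx⟩ := ENNReal.lt_iff_exists_nnreal_btwn.1 hx
  have hy : (0 : ℝ) < y := by exact_mod_cast hy0
  refine ((hW (y / C) (by positivity)).and_eventually (eventually_ge_atTop 1)).mono
    fun n hn => (hg n hn.2).trans (le_trans ?_ hyx.le)
  rw [← ENNReal.ofReal_coe_nnreal]
  refine ENNReal.ofReal_le_ofReal ?_
  have := (le_div_iff₀ hC).1 hn.1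
  linarith

theorem limsup_eq_top_of_scales (ha : 0 < a) (hR : ∀ n, 0 < R n)
    (hlim : Tendsto R atTop (𝓝 0)) (hc : 0 < c)
    (hg : ∀ n, 1 ≤ n → ENNReal.ofReal (c * W n) ≤ g (a * R n))
    (hW : ∀ M : ℝ, ∃ᶠ n in atTop, M ≤ W n) : limsup g (𝓝[>] 0) = ∞ := by
  refine ENNReal.eq_top_of_forall_nnreal_le fun x => ?_
  refine le_limsup_of_frequently_le' ((tendsto_const_mul_scales ha hR hlim).frequently ?_)
  refine ((hW (x / c)).and_eventually (eventually_ge_atTop 1)).mono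
    fun n hn => le_trans ?_ (hg n hn.2)
  rw [← ENNReal.ofReal_coe_nnreal]
  refine ENNReal.ofReal_le_ofReal ?_
  have := (div_le_iff₀ hc).1 hn.1
  linarith

/-- Bounding `1 / ε` below by `1 / y` is enough and avoids computing a logarithm. -/
theorem ofReal_mul_le_lintegral_inv {x y z : ℝ} (hx : 0 < x) (hxy : x ≤ y) (hz : 0 ≤ z)
    (hg : ∀ ε ∈ Set.Icc x y, ENNReal.ofReal z ≤ g ε) :
    ENNReal.ofReal (z * (1 - x / y)) ≤
      ∫⁻ ε in Set.Icc x y, g ε * ENNReal.ofReal (1 / ε) := by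
  have hy := hx.trans_le hxy
  calc ENNReal.ofReal (z * (1 - x / y))
      = ∫⁻ _ε in Set.Icc x y, ENNReal.ofReal z * ENNReal.ofReal (1 / y) := by
        rw [setLIntegral_const, Real.volume_Icc, ← ENNReal.ofReal_mul hz,
          ← ENNReal.ofReal_mul (by positivity)]
        congr 1
        field_simp
    _ ≤ _ := setLIntegral_mono' measurableSet_Icc fun ε hε => by
        have h1 := hg ε hε
        have h0 := hx.trans_le hε.1
        have h2 := hε.2
        gcongr

/-- A single window with `W k ≥ M * n` already contributes a multiple of `M * n` to the integral,
while `|log δ|` is of order at most `n`. -/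
theorem tendsto_logMean_top_of_scales (ha : 1 ≤ a) (hR : ∀ n, 0 < R n) (hR0 : R 0 = 1)
    (hanti : Antitone R) (hlim : Tendsto R atTop (𝓝 0)) (hq : 0 < q) (hq1 : q < 1)
    (hqR : ∀ n, q * R n ≤ R (n + 1)) (hc : 0 < c)
    (hg : ∀ n, 1 ≤ n → ∀ ε ∈ Set.Icc (a * R n) (a / q * R n), ENNReal.ofReal (c * W n) ≤ g ε)
    (hW : ∀ (M : ℝ) (m : ℕ), ∀ᶠ n : ℕ in atTop, ∃ k, m ≤ k ∧ k ≤ n ∧ M * n ≤ W k) :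
    Tendsto (fun δ => (∫⁻ ε in Set.Icc δ 1, g ε * ENNReal.ofReal (1 / ε)) /
      ENNReal.ofReal |Real.log δ|) (𝓝[>] 0) (𝓝 ∞) := by
  have ha0 : 0 < a := one_pos.trans_le ha
  have hL : 0 < -Real.log q := neg_pos.2 (Real.log_neg hq hq1)
  have hpow : ∀ n, q ^ n ≤ R n := fun n => by
    induction n with
    | zero => rw [hR0, pow_zero]
    | succ n ih =>
      rw [pow_succ']
      exact (mul_le_mul_of_nonneg_left ih hq.le).trans (hqR n)
  -- Windows of index at least `m` lie below `1`, inside the domain of integration.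
  obtain ⟨m, hm⟩ : ∃ m, ∀ k ≥ m, a / q * R k ≤ 1 := by
    have h : Tendsto (fun n => a / q * R n) atTop (𝓝 0) := by simpa using hlim.const_mul (a / q)
    exact eventually_atTop.1 (h.eventually_le_const one_pos)
  refine ENNReal.tendsto_nhds_top_iff_nnreal.2 fun x =>
    eventually_nhdsGT_zero_of_scales ha0 hR hanti hlim ?_
  have hq' : 0 < 1 - q := by linarith
  -- Chosen so that the window's contribution is at least `x + 1` times the bound `2 * n * -log q`
  -- for `|log δ|`; the extra `1` gives strictness.
  set M := (x + 1 : ℝ) * (2 * -Real.log q) / (c * (1 - q)) with hM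
  have hM0 : 0 < M := by positivity
  have hlt : Tendsto (fun n => a * R n) atTop (𝓝 0) := by simpa using hlim.const_mul a
  filter_upwards [hW M (max m 1), eventually_ge_atTop 1, hlt.eventually_lt_const one_pos]
    with n hn hn1 han δ hδ
  obtain ⟨k, hmk, hkn, hk⟩ := hn
  have hn1' : (1 : ℝ) ≤ n := by exact_mod_cast hn1
  have hδ0 : 0 < δ := (mul_pos ha0 (hR _)).trans_le hδ.1
  have hδ1 : δ < 1 := hδ.2.trans_lt han
  have hlog : |Real.log δ| ≤ 2 * n * -Real.log q := by
    rw [abs_of_neg (Real.log_neg hδ0 hδ1)]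
    have h1 : q ^ (n + 1) ≤ δ := by
      refine (hpow (n + 1)).trans (le_trans ?_ hδ.1)
      exact le_mul_of_one_le_left (hR _).le ha
    have h2 := Real.log_le_log (by positivity) h1
    rw [Real.log_pow] at h2
    push_cast at h2
    nlinarith
  have hlog0 : 0 < |Real.log δ| := abs_pos.2 (Real.log_neg hδ0 hδ1).ne
  have hsub : Set.Icc (a * R k) (a / q * R k) ⊆ Set.Icc δ 1 :=
    Set.Icc_subset_Icc (hδ.2.trans (mul_le_mul_of_nonneg_left (hanti hkn) ha0.le))
      (hm k ((le_max_left _ _).trans hmk))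
  have hWk : 0 ≤ W k := le_trans (by positivity) hk
  have haq : a * R k ≤ a / q * R k := by
    refine mul_le_mul_of_nonneg_right ?_ (hR k).le
    exact le_div_self ha0.le hq hq1.le
  have hint := ofReal_mul_le_lintegral_inv (g := g) (mul_pos ha0 (hR k)) haq
    (mul_nonneg hc.le hWk) (hg k ((le_max_right _ _).trans hmk))
  have hratio : a * R k / (a / q * R k) = q := by
    have := (hR k).ne'
    field_simp
  rw [hratio] at hint
  rw [ENNReal.lt_div_iff_mul_lt (Or.inl (ENNReal.ofReal_pos.2 hlog0).ne')
    (Or.inl ENNReal.ofReal_ne_top)]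
  refine lt_of_lt_of_le ?_ (hint.trans (lintegral_mono_set hsub))
  rw [← ENNReal.ofReal_coe_nnreal, ← ENNReal.ofReal_mul x.coe_nonneg]
  have hxM : (x + 1 : ℝ) * (2 * n * -Real.log q) ≤ c * W k * (1 - q) := by
    have e : (x + 1 : ℝ) * (2 * n * -Real.log q) = c * (M * n) * (1 - q) := by
      rw [hM]
      field_simp
    rw [e]
    gcongr
  have hx0 : (0 : ℝ) ≤ x := x.2
  have hlt' : (x : ℝ) * |Real.log δ| < c * W k * (1 - q) := by
    have h1 := mul_le_mul_of_nonneg_left hlog (by positivity : (0 : ℝ) ≤ x + 1)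
    linarith
  exact ENNReal.ofReal_lt_ofReal_iff'.2 ⟨hlt', lt_of_le_of_lt (by positivity) hlt'⟩

end Scales

/-! ### Attractors of a realisation in terms of the walk of logarithmic partition sums -/

section Realisation

variable {ω : ℕ → Tuple d rmin rmax} {r : ℕ → ℝ}

theorem mem_Icc_of_ratio_eq (hr : ∀ i j, (ω i).ratio j = r i) (i : ℕ) : r i ∈ Set.Icc rmin rmax := by
  rw [← hr i ⟨0, (ω i).N_pos⟩]
  exact ((ω i).2 _).2.1

theorem prod_pos_of_ratio_eq (hr : ∀ i j, (ω i).ratio j = r i) (n : ℕ) :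
    0 < ∏ i ∈ Finset.range n, r i :=
  Finset.prod_pos fun i _ => by
    rw [← hr i ⟨0, (ω i).N_pos⟩]
    exact Sim.ratio_pos _

theorem prod_le_pow_of_ratio_eq (hr : ∀ i j, (ω i).ratio j = r i) (n : ℕ) :
    ∏ i ∈ Finset.range n, r i ≤ rmax ^ n := by
  have h := cylinderRatio_le_pow (fun i => ⟨0, (ω i).N_pos⟩ : Coding ω) n
  rwa [cylinderRatio, Finset.prod_congr rfl fun i _ => hr i _] at h

theorem rmax_nonneg_of_ratio_eq (hr : ∀ i j, (ω i).ratio j = r i) : 0 ≤ rmax := by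
  have h := prod_pos_of_ratio_eq hr 1
  rw [Finset.prod_range_one] at h
  exact h.le.trans (mem_Icc_of_ratio_eq hr 0).2

theorem antitone_prod_of_ratio_eq (hrmax : rmax < 1) (hr : ∀ i j, (ω i).ratio j = r i) :
    Antitone fun n => ∏ i ∈ Finset.range n, r i :=
  antitone_nat_of_succ_le fun n => by
    rw [Finset.prod_range_succ]
    exact mul_le_of_le_one_right (prod_pos_of_ratio_eq hr n).le
      ((mem_Icc_of_ratio_eq hr n).2.trans hrmax.le)

theorem tendsto_prod_of_ratio_eq (hrmax : rmax < 1) (hr : ∀ i j, (ω i).ratio j = r i) :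
    Tendsto (fun n => ∏ i ∈ Finset.range n, r i) atTop (𝓝 0) :=
  squeeze_zero (fun n => (prod_pos_of_ratio_eq hr n).le) (prod_le_pow_of_ratio_eq hr)
    (tendsto_pow_atTop_nhds_zero_of_lt_one (rmax_nonneg_of_ratio_eq hr) hrmax)

theorem mul_prod_le_prod_succ_of_ratio_eq (hr : ∀ i j, (ω i).ratio j = r i) (n : ℕ) :
    rmin * ∏ i ∈ Finset.range n, r i ≤ ∏ i ∈ Finset.range (n + 1), r i := by
  rw [Finset.prod_range_succ, mul_comm]
  exact mul_le_mul_of_nonneg_left (mem_Icc_of_ratio_eq hr n).1 (prod_pos_of_ratio_eq hr n).le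

theorem prod_partitionSum_eq_exp (hrmin : 0 < rmin) (hr : ∀ i j, (ω i).ratio j = r i) (t : ℝ)
    (n : ℕ) : ∏ i ∈ Finset.range n, ((ω i).N * r i ^ t) =
      Real.exp (∑ i ∈ Finset.range n, Real.log ((ω i).N * r i ^ t)) := by
  rw [Real.exp_sum]
  refine Finset.prod_congr rfl fun i _ => (Real.exp_log ?_).symm
  have h1 := hrmin.trans_le (mem_Icc_of_ratio_eq hr i).1
  have h2 : (0 : ℝ) < (ω i).N := by exact_mod_cast (ω i).N_pos
  positivity

theorem sum_log_partitionSum_eq (hrmin : 0 < rmin) (hr : ∀ i j, (ω i).ratio j = r i) (s t : ℝ)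
    (n : ℕ) : ∑ i ∈ Finset.range n, Real.log ((ω i).N * r i ^ t) =
      ∑ i ∈ Finset.range n, Real.log ((ω i).N * r i ^ s) +
        (t - s) * ∑ i ∈ Finset.range n, Real.log (r i) := by
  rw [Finset.mul_sum, ← Finset.sum_add_distrib]
  refine Finset.sum_congr rfl fun i _ => ?_
  have h1 := hrmin.trans_le (mem_Icc_of_ratio_eq hr i).1
  have h2 : (0 : ℝ) < (ω i).N := by exact_mod_cast (ω i).N_pos
  rw [Real.log_mul h2.ne' (by positivity), Real.log_mul h2.ne' (by positivity),
    Real.log_rpow h1, Real.log_rpow h1]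
  ring

theorem sum_log_ratio_le (hrmin : 0 < rmin) (hr : ∀ i j, (ω i).ratio j = r i) (n : ℕ) :
    ∑ i ∈ Finset.range n, Real.log (r i) ≤ n * Real.log rmax := by
  have h := Finset.sum_le_card_nsmul (Finset.range n) (fun i => Real.log (r i)) (Real.log rmax)
    fun i _ => Real.log_le_log (hrmin.trans_le (mem_Icc_of_ratio_eq hr i).1)
      (mem_Icc_of_ratio_eq hr i).2
  rwa [Finset.card_range, nsmul_eq_mul] at h

variable {γ : ℝ} {x₀ : E d}

/-- The Minkowski dimension is the exponent whose walk of logarithmic partition sums is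
sublinear. -/
theorem hasMinkowskiDim_attractor (hrmin : 0 < rmin) (hrmax : rmax < 1)
    (hr : ∀ i j, (ω i).ratio j = r i) (hγ : 0 < γ)
    (hsep : ∀ v w : Coding ω, ∀ n m : ℕ, 1 ≤ n → 1 ≤ m → ¬ (n = m ∧ ∀ i < n, v i = w i) →
      γ * min (cylinderRatio ω v n) (cylinderRatio ω w m) ≤
        ‖cylinderMap ω v n x₀ - cylinderMap ω w m x₀‖) {s : ℝ}
    (hs : Tendsto (fun n : ℕ => (∑ i ∈ Finset.range n, Real.log ((ω i).N * r i ^ s)) / n)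
      atTop (𝓝 0)) : HasMinkowskiDim (attractor ω) s := by
  have ha : 0 < γ / 2 + 1 + ‖x₀‖ := by positivity
  have hrm0 : 0 < rmax :=
    (hrmin.trans_le (mem_Icc_of_ratio_eq hr 0).1).trans_le (mem_Icc_of_ratio_eq hr 0).2
  have hlog : Real.log rmax < 0 := Real.log_neg hrm0 hrmax
  have hn : Tendsto (fun n : ℕ => (n : ℝ)) atTop atTop := tendsto_natCast_atTop_atTop
  have hlim : ∀ t, Tendsto (fun n : ℕ => (∑ i ∈ Finset.range n, Real.log ((ω i).N * r i ^ s)) / n +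
      (t - s) * Real.log rmax) atTop (𝓝 ((t - s) * Real.log rmax)) := fun t => by
    simpa using hs.add_const ((t - s) * Real.log rmax)
  have hdiv : ∀ (t : ℝ) (n : ℕ), (n : ℝ) * ((∑ i ∈ Finset.range n,
      Real.log ((ω i).N * r i ^ s)) / n + (t - s) * Real.log rmax) =
      ∑ i ∈ Finset.range n, Real.log ((ω i).N * r i ^ s) + (t - s) * (n * Real.log rmax) := by
    intro t n
    rcases Nat.eq_zero_or_pos n with rfl | hn
    · simp
    · have : (n : ℝ) ≠ 0 := by exact_mod_cast hn.ne'
      field_simp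
  refine ⟨fun t ht => ?_, fun t ht => ?_⟩ <;>
    obtain ⟨c, C, hc, hC, h⟩ := exists_scaledVolume_bounds hrmax hr hγ hsep
      ((γ / 2 + 1 + ‖x₀‖) / rmin) t
  · refine tendsto_top_of_scales ha (prod_pos_of_ratio_eq hr) (antitone_prod_of_ratio_eq hrmax hr)
      (tendsto_prod_of_ratio_eq hrmax hr) hrmin (mul_prod_le_prod_succ_of_ratio_eq hr) hc
      (fun n hn ε hε => (h n hn ε hε).1) ?_
    simp_rw [prod_partitionSum_eq_exp hrmin hr]
    -- For `t < s` the drift is at least `(t - s) * n * log rmax`, a product of two negative factors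
    -- times `n`, which outweighs the sublinear walk.
    refine Real.tendsto_exp_atTop.comp (tendsto_atTop_mono (fun n => ?_)
      (hn.atTop_mul_pos (mul_pos_of_neg_of_neg (sub_neg.2 ht) hlog) (hlim t)))
    rw [hdiv, sum_log_partitionSum_eq hrmin hr s t]
    have := mul_le_mul_of_nonpos_left (sum_log_ratio_le hrmin hr n) (sub_neg.2 ht).le
    linarith
  · refine tendsto_zero_of_scales ha (prod_pos_of_ratio_eq hr) (antitone_prod_of_ratio_eq hrmax hr)
      (tendsto_prod_of_ratio_eq hrmax hr) hrmin (mul_prod_le_prod_succ_of_ratio_eq hr)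
      (fun n hn ε hε => (h n hn ε hε).2) ?_
    simp_rw [prod_partitionSum_eq_exp hrmin hr]
    refine Real.tendsto_exp_atBot.comp (tendsto_atBot_mono (fun n => ?_)
      (hn.atTop_mul_neg (mul_neg_of_pos_of_neg (sub_pos.2 ht) hlog) (hlim t)))
    rw [hdiv, sum_log_partitionSum_eq hrmin hr s t]
    have := mul_le_mul_of_nonneg_left (sum_log_ratio_le hrmin hr n) (sub_pos.2 ht).le
    linarith

/-- The Minkowski contents when the walk of logarithmic partition sums oscillates. -/
theorem minkowskiContents_attractor (hrmin : 0 < rmin) (hrmax : rmax < 1)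
    (hr : ∀ i j, (ω i).ratio j = r i) (hγ : 0 < γ)
    (hsep : ∀ v w : Coding ω, ∀ n m : ℕ, 1 ≤ n → 1 ≤ m → ¬ (n = m ∧ ∀ i < n, v i = w i) →
      γ * min (cylinderRatio ω v n) (cylinderRatio ω w m) ≤
        ‖cylinderMap ω v n x₀ - cylinderMap ω w m x₀‖) {s : ℝ}
    (hup : ∀ (M : ℝ) (m : ℕ), ∀ᶠ n : ℕ in atTop, ∃ k, m ≤ k ∧ k ≤ n ∧
      M * n ≤ Real.exp (∑ i ∈ Finset.range k, Real.log ((ω i).N * r i ^ s)))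
    (hdown : ∀ (M : ℝ) (m : ℕ), ∀ᶠ n : ℕ in atTop, ∃ k, m ≤ k ∧ k ≤ n ∧
      M * n ≤ Real.exp (∑ i ∈ Finset.range k, -Real.log ((ω i).N * r i ^ s))) :
    lowerMinkowskiContent s (attractor ω) = 0 ∧ upperMinkowskiContent s (attractor ω) = ∞ ∧
      HasAverageMinkowskiContent s (attractor ω) ∞ := by
  have ha1 : 1 ≤ γ / 2 + 1 + ‖x₀‖ := by linarith [norm_nonneg x₀]
  have ha : 0 < γ / 2 + 1 + ‖x₀‖ := one_pos.trans_le ha1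
  have hrmin1 : rmin < 1 :=
    ((mem_Icc_of_ratio_eq hr 0).1.trans (mem_Icc_of_ratio_eq hr 0).2).trans_lt hrmax
  obtain ⟨c, C, hc, hC, h⟩ := exists_scaledVolume_bounds hrmax hr hγ hsep
    ((γ / 2 + 1 + ‖x₀‖) / rmin) s
  simp_rw [prod_partitionSum_eq_exp hrmin hr] at h
  have hmem : ∀ n, (γ / 2 + 1 + ‖x₀‖) * ∏ i ∈ Finset.range n, r i ∈
      Set.Icc ((γ / 2 + 1 + ‖x₀‖) * ∏ i ∈ Finset.range n, r i)
        ((γ / 2 + 1 + ‖x₀‖) / rmin * ∏ i ∈ Finset.range n, r i) := fun n =>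
    ⟨le_rfl, mul_le_mul_of_nonneg_right (le_div_self ha.le hrmin hrmin1.le)
      (prod_pos_of_ratio_eq hr n).le⟩
  -- The lower bound `m ≤ k` forces large values at arbitrarily late indices, which is all the two
  -- contents need.
  have hfreq : ∀ {u : ℕ → ℝ}, (∀ (M : ℝ) (m : ℕ), ∀ᶠ n : ℕ in atTop, ∃ k, m ≤ k ∧ k ≤ n ∧
      M * n ≤ u k) → ∀ M : ℝ, ∃ᶠ n in atTop, M ≤ u n := by
    intro u hu M
    refine frequently_atTop.2 fun m => ?_
    obtain ⟨n, ⟨k, hmk, -, hk⟩, hn⟩ := ((hu (max M 0) m).and (eventually_ge_atTop 1)).exists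
    have hn' : (1 : ℝ) ≤ n := by exact_mod_cast hn
    exact ⟨k, hmk, (le_max_left M 0).trans
      ((le_mul_of_one_le_right (le_max_right M 0) hn').trans hk)⟩
  refine ⟨?_, ?_, ?_⟩
  · refine liminf_eq_zero_of_scales ha (prod_pos_of_ratio_eq hr)
      (tendsto_prod_of_ratio_eq hrmax hr) hC (fun n hn => (h n hn _ (hmem n)).2) fun η hη => ?_
    refine (hfreq hdown η⁻¹).mono fun n hn => ?_
    rw [Finset.sum_neg_distrib, Real.exp_neg] at hn
    exact (inv_le_inv₀ hη (Real.exp_pos _)).1 hn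
  · exact limsup_eq_top_of_scales ha (prod_pos_of_ratio_eq hr)
      (tendsto_prod_of_ratio_eq hrmax hr) hc (fun n hn => (h n hn _ (hmem n)).1) (hfreq hup)
  · exact tendsto_logMean_top_of_scales ha1 (prod_pos_of_ratio_eq hr) (Finset.prod_range_zero r)
      (antitone_prod_of_ratio_eq hrmax hr) (tendsto_prod_of_ratio_eq hrmax hr) hrmin hrmin1
      (mul_prod_le_prod_succ_of_ratio_eq hr) hc (fun n hn ε hε => (h n hn ε hε).1) hup

end Realisation

/-! ### Measurability and the law of the coordinates -/

/-- With two distinct points the ratio is a quotient of distances, continuous for pointwise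
convergence; on a one-point space it is `1` by convention. -/
theorem measurable_sim_ratio : Measurable (Sim.ratio : Sim d rmin rmax → ℝ) := by
  rcases subsingleton_or_nontrivial (E d) with hE | hE
  · have : (Sim.ratio : Sim d rmin rmax → ℝ) = fun _ => 1 := by
      funext f
      simp [Sim.ratio, Dilation.ratio_of_subsingleton]
    rw [this]
    exact measurable_const
  · obtain ⟨x, y, hxy⟩ := exists_pair_ne (E d)
    have h : (Sim.ratio : Sim d rmin rmax → ℝ) = fun f => dist (f.map x) (f.map y) / dist x y := by
      funext f
      rw [Sim.dist_map, mul_div_cancel_right₀ _ (dist_ne_zero.2 hxy)]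
    have hmap : Continuous (Sim.map : Sim d rmin rmax → E d → E d) := continuous_induced_dom
    have hc : Continuous (Sim.ratio : Sim d rmin rmax → ℝ) := by
      rw [h]
      exact ((continuous_apply x |>.comp hmap).dist (continuous_apply y |>.comp hmap)).div_const _
    exact hc.measurable

theorem measurable_tuple_iff {β : Type*} [MeasurableSpace β] {f : Tuple d rmin rmax → β} :
    Measurable f ↔ ∀ k, Measurable fun w => f ⟨k, w⟩ := by
  refine ⟨fun hf k s hs => ?_, fun hf s hs => ?_⟩
  · exact MeasurableSpace.measurableSet_iInf.1 (hf hs) k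
  · exact MeasurableSpace.measurableSet_iInf.2 fun k => hf k hs

theorem Tuple.measurable_N : Measurable (Tuple.N : Tuple d rmin rmax → ℕ) :=
  measurable_tuple_iff.2 fun k => (measurable_const : Measurable fun _ => (k : ℕ))

/-- The contraction ratio of the first map of a tuple. -/
def Tuple.firstRatio (l : Tuple d rmin rmax) : ℝ := l.ratio ⟨0, l.N_pos⟩

theorem Tuple.measurable_firstRatio : Measurable (Tuple.firstRatio : Tuple d rmin rmax → ℝ) :=
  measurable_tuple_iff.2 fun k => measurable_sim_ratio.comp (measurable_pi_apply (⟨0, k.pos⟩ : Fin k))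

theorem Tuple.firstRatio_mem_Icc (l : Tuple d rmin rmax) : l.firstRatio ∈ Set.Icc rmin rmax :=
  (l.2 _).2.1

theorem exists_ae_N_le {P₁ : Measure (Tuple d rmin rmax)} (hN : essSupN P₁ < ⊤) :
    ∃ K : ℕ, 1 ≤ K ∧ ∀ᵐ l ∂P₁, l.N ≤ K := by
  obtain ⟨K, hK⟩ := ENat.ne_top_iff_exists.1 hN.ne
  -- The successor lies strictly above the essential supremum, and it is positive.
  refine ⟨K + 1, K.succ_pos.trans_le le_rfl, ?_⟩
  have h : essSup (fun l : Tuple d rmin rmax => (l.N : ℕ∞)) P₁ < ((K + 1 : ℕ) : ℕ∞) := by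
    rw [show essSup (fun l : Tuple d rmin rmax => (l.N : ℕ∞)) P₁ = (K : ℕ∞) from hK.symm]
    exact_mod_cast K.lt_succ_self
  filter_upwards [ae_lt_of_essSup_lt h] with l hl
  exact (Nat.cast_lt.1 hl).le

section Law

variable {P₁ : Measure (Tuple d rmin rmax)} [IsProbabilityMeasure P₁]

theorem measurePreserving_eval_law (i : ℕ) : MeasurePreserving (fun ω => ω i) (law P₁) P₁ :=
  measurePreserving_eval_infinitePi (fun _ : ℕ => P₁) i

instance : IsProbabilityMeasure (law P₁) := by
  unfold law
  infer_instance

theorem integral_comp_eval_law {f : Tuple d rmin rmax → ℝ} (hf : Measurable f) (i : ℕ) :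
    ∫ ω, f (ω i) ∂(law P₁) = ∫ l, f l ∂P₁ := by
  have h := integral_map (measurePreserving_eval_law (P₁ := P₁) i).measurable.aemeasurable
    (hf.aestronglyMeasurable (μ := Measure.map (fun ω => ω i) (law P₁)))
  rw [(measurePreserving_eval_law (P₁ := P₁) i).map_eq] at h
  exact h.symm

theorem ae_forall_eval_law {p : Tuple d rmin rmax → Prop} (hp : ∀ᵐ l ∂P₁, p l) :
    ∀ᵐ ω ∂(law P₁), ∀ i, p (ω i) :=
  ae_all_iff.2 fun i => (measurePreserving_eval_law (P₁ := P₁) i).quasiMeasurePreserving.ae hp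

theorem iIndepFun_law {f : Tuple d rmin rmax → ℝ} (hf : Measurable f) :
    ProbabilityTheory.iIndepFun (fun (i : ℕ) ω => f (ω i)) (law P₁) :=
  ProbabilityTheory.iIndepFun_infinitePi (P := fun _ : ℕ => P₁) (X := fun _ => f) fun _ => hf

theorem ae_tendsto_mean_law {f : Tuple d rmin rmax → ℝ} (hf : Measurable f)
    (hint : Integrable f P₁) :
    ∀ᵐ ω ∂(law P₁), Tendsto (fun n : ℕ => (∑ i ∈ Finset.range n, f (ω i)) / n) atTop
      (𝓝 (∫ l, f l ∂P₁)) := by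
  have hm := fun i : ℕ => measurePreserving_eval_law (P₁ := P₁) i
  have hint0 : Integrable (fun ω : ℕ → Tuple d rmin rmax => f (ω 0)) (law P₁) :=
    (hm 0).integrable_comp_of_integrable hint
  have hind := iIndepFun_law (P₁ := P₁) hf
  have hmap : ∀ i : ℕ, Measure.map (fun ω : ℕ → Tuple d rmin rmax => f (ω i)) (law P₁) =
      Measure.map f P₁ := fun i =>
    (Measure.map_map hf (hm i).measurable).symm.trans (congrArg (Measure.map f) (hm i).map_eq)
  have hid : ∀ i : ℕ, ProbabilityTheory.IdentDistrib
      (fun ω : ℕ → Tuple d rmin rmax => f (ω i)) (fun ω => f (ω 0)) (law P₁) (law P₁) := fun i =>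
    ⟨(hf.comp (hm i).measurable).aemeasurable, (hf.comp (hm 0).measurable).aemeasurable,
      (hmap i).trans (hmap 0).symm⟩
  have hpair : ∀ i j : ℕ, i ≠ j → ProbabilityTheory.IndepFun
      (fun ω : ℕ → Tuple d rmin rmax => f (ω i)) (fun ω => f (ω j)) (law P₁) :=
    fun i j hij => hind.indepFun hij
  rw [← integral_comp_eval_law hf 0]
  exact ProbabilityTheory.strong_law_ae_real (fun i (ω : ℕ → Tuple d rmin rmax) => f (ω i)) hint0
    (fun i j hij => hpair i j hij) hid

/-- A bounded, centred, nondegenerate function of i.i.d. coordinates: the exponential walk has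
running maxima that grow faster than linearly. -/
theorem ae_eventually_exists_mul_le_exp_law {f : Tuple d rmin rmax → ℝ} (hf : Measurable f) {c : ℝ}
    (hc : ∀ l, |f l| ≤ c) (hmean : ∫ l, f l ∂P₁ = 0) (hne : ¬ ∀ᵐ l ∂P₁, f l = 0) :
    ∀ᵐ ω ∂(law P₁), ∀ (M : ℝ) (m : ℕ), ∀ᶠ n : ℕ in atTop, ∃ k, m ≤ k ∧ k ≤ n ∧
      M * n ≤ Real.exp (∑ i ∈ Finset.range k, f (ω i)) := by
  have hsq : Integrable (fun l => f l ^ 2) P₁ :=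
    integrable_of_measurable_of_bound (hf.pow_const 2) (C := c ^ 2) fun l => by
      rw [abs_pow]
      exact pow_le_pow_left₀ (abs_nonneg _) (hc l) 2
  have hv : 0 < ∫ l, f l ^ 2 ∂P₁ := by
    refine lt_of_le_of_ne (integral_nonneg fun l => sq_nonneg _) fun h => hne ?_
    filter_upwards [(integral_eq_zero_iff_of_nonneg (fun l => sq_nonneg _) hsq).1 h.symm] with l hl
    exact pow_eq_zero_iff two_ne_zero |>.1 hl
  have hZ : ∀ i : ℕ, Measurable fun ω : ℕ → Tuple d rmin rmax => f (ω i) := fun i =>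
    hf.comp (measurable_pi_apply i)
  have hm : ∀ i : ℕ, ∫ ω, f (ω i) ∂(law P₁) = 0 := fun i =>
    (integral_comp_eval_law hf i).trans hmean
  have hvar : ∀ i : ℕ, ∫ ω, f (ω i) ^ 2 ∂(law P₁) = ∫ l, f l ^ 2 ∂P₁ := fun i =>
    integral_comp_eval_law (f := fun l => f l ^ 2) (hf.pow_const 2) i
  have hind := iIndepFun_law (P₁ := P₁) hf
  exact ae_eventually_exists_mul_le_exp (μ := law P₁) (Z := fun i ω => f (ω i)) hZ hind
    (fun i ω => hc (ω i)) hm hvar hv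

end Law

/-! ### The centring exponent -/

/-- The mean of `log N + s log r` is affine in `s` with slope `E log r ≤ log rmax < 0`, so it has a
zero. The number of maps is truncated at its almost sure bound, so that `f` is bounded everywhere,
as the walk estimates require. -/
theorem exists_centring_exponent (hrmin : 0 < rmin) (hrmax : rmax < 1)
    (P₁ : Measure (Tuple d rmin rmax)) [IsProbabilityMeasure P₁] (hN : essSupN P₁ < ⊤) :
    ∃ (s : ℝ) (f : Tuple d rmin rmax → ℝ), Measurable f ∧ (∃ c, ∀ l, |f l| ≤ c) ∧
      ∫ l, f l ∂P₁ = 0 ∧ ∀ᵐ l ∂P₁, f l = Real.log (l.N * l.firstRatio ^ s) := by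
  obtain ⟨K, hK1, hK⟩ := exists_ae_N_le hN
  let X : Tuple d rmin rmax → ℝ := fun l => Real.log (min l.N K : ℕ)
  let Y : Tuple d rmin rmax → ℝ := fun l => Real.log l.firstRatio
  have hXm : Measurable X := Real.measurable_log.comp
    (measurable_from_nat.comp (Tuple.measurable_N.min measurable_const))
  have hYm : Measurable Y := Real.measurable_log.comp Tuple.measurable_firstRatio
  have hXb : ∀ l, |X l| ≤ Real.log K := fun l => by
    have h1 : 1 ≤ min l.N K := le_min l.N_pos hK1
    rw [abs_of_nonneg (Real.log_natCast_nonneg _)]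
    exact Real.log_le_log (by exact_mod_cast h1) (by exact_mod_cast min_le_right _ _)
  have hY2 : ∀ l, Y l ≤ Real.log rmax := fun l =>
    Real.log_le_log (hrmin.trans_le l.firstRatio_mem_Icc.1) l.firstRatio_mem_Icc.2
  have hY0 : Real.log rmax < 0 := by
    obtain ⟨l⟩ := nonempty_of_isProbabilityMeasure P₁
    exact Real.log_neg
      ((hrmin.trans_le l.firstRatio_mem_Icc.1).trans_le l.firstRatio_mem_Icc.2) hrmax
  have hYb : ∀ l, |Y l| ≤ -Real.log rmin := fun l => by
    rw [abs_of_nonpos ((hY2 l).trans hY0.le)]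
    exact neg_le_neg (Real.log_le_log hrmin l.firstRatio_mem_Icc.1)
  have hXi : Integrable X P₁ := integrable_of_measurable_of_bound hXm hXb
  have hYi : Integrable Y P₁ := integrable_of_measurable_of_bound hYm hYb
  have hYint : ∫ l, Y l ∂P₁ < 0 := by
    refine lt_of_le_of_lt (integral_mono hYi (integrable_const (Real.log rmax)) hY2) ?_
    simpa using hY0
  set s := -(∫ l, X l ∂P₁) / ∫ l, Y l ∂P₁ with hs
  refine ⟨s, fun l => X l + s * Y l, hXm.add (hYm.const_mul s),
    ⟨Real.log K + |s| * -Real.log rmin, fun l => ?_⟩, ?_, ?_⟩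
  · refine (abs_add_le _ _).trans (add_le_add (hXb l) ?_)
    rw [abs_mul]
    exact mul_le_mul_of_nonneg_left (hYb l) (abs_nonneg s)
  · rw [integral_add hXi (hYi.const_mul s), integral_const_mul, hs, div_mul_cancel₀ _ hYint.ne]
    ring
  · filter_upwards [hK] with l hl
    have h1 := hrmin.trans_le l.firstRatio_mem_Icc.1
    have h2 : (0 : ℝ) < l.N := by exact_mod_cast l.N_pos
    rw [Real.log_mul h2.ne' (by positivity), Real.log_rpow h1]
    simp only [X, Y, min_eq_left hl]

end RIFS

end

/-! ### Conclusion for the random attractor -/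

theorem theorem2 (d : ℕ) (rmin rmax : ℝ) (hrmin : 0 < rmin) (hrmax : rmax < 1)
    (P₁ : Measure (RIFS.Tuple d rmin rmax)) [IsProbabilityMeasure P₁]
    (hsep : RIFS.UniformCylinderSeparation P₁)
    (hdet : ¬ RIFS.AlmostDeterministic P₁)
    (hN₂ : 2 ≤ RIFS.essSupN P₁) (hN : RIFS.essSupN P₁ < ⊤)
    (hequi : RIFS.Equicontractive P₁) :
    ∃ s : ℝ,
      (∀ᵐ ω ∂(RIFS.law P₁), RIFS.HasMinkowskiDim (RIFS.attractor ω) s) ∧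
      ∀ᵐ ω ∂(RIFS.law P₁),
        RIFS.lowerMinkowskiContent s (RIFS.attractor ω) = 0 ∧
        RIFS.upperMinkowskiContent s (RIFS.attractor ω) = ⊤ ∧
        RIFS.lowerAverageMinkowskiContent s (RIFS.attractor ω) = ⊤ ∧
        RIFS.upperAverageMinkowskiContent s (RIFS.attractor ω) = ⊤ ∧
        RIFS.HasAverageMinkowskiContent s (RIFS.attractor ω) ⊤ := by
  obtain ⟨s, f, hf, ⟨c, hc⟩, hmean, hfs⟩ := RIFS.exists_centring_exponent hrmin hrmax P₁ hN
  obtain ⟨γ, hγ, x₀, hsep⟩ := hsep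
  have hfirst : ∀ᵐ l ∂P₁, ∀ i : Fin l.N, l.ratio i = l.firstRatio := by
    filter_upwards [hequi] with l ⟨r, hr⟩ i
    exact (hr i).trans (hr _).symm
  -- With equal ratios, a vanishing increment says `N r^s = 1`, which is exactly almost determinism
  -- with this `s`.
  have hne : ¬ ∀ᵐ l ∂P₁, f l = 0 := by
    refine fun h => hdet ⟨s, ?_⟩
    filter_upwards [h, hfs, hfirst] with l h0 hl hl'
    have h1 := hrmin.trans_le l.firstRatio_mem_Icc.1
    have h2 : (0 : ℝ) < l.N := by exact_mod_cast l.N_pos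
    rw [h0] at hl
    have h3 : (l.N : ℝ) * l.firstRatio ^ s = 1 :=
      Real.eq_one_of_pos_of_log_eq_zero (by positivity) hl.symm
    simp only [hl', Finset.sum_const, Finset.card_univ, Fintype.card_fin, nsmul_eq_mul]
    exact h3
  have hfi : Integrable f P₁ := RIFS.integrable_of_measurable_of_bound hf hc
  have hslln := RIFS.ae_tendsto_mean_law hf hfi
  rw [hmean] at hslln
  have hup := RIFS.ae_eventually_exists_mul_le_exp_law hf hc hmean hne
  -- The reflected walk satisfies the same hypotheses, and its large values are the small values of
  -- the partition sums.
  have hdown := RIFS.ae_eventually_exists_mul_le_exp_law (f := fun l => -f l) hf.neg (c := c)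
    (fun l => (abs_neg (f l)).trans_le (hc l)) (by rw [integral_neg, hmean, neg_zero])
    (fun h => hne (h.mono fun l hl => neg_eq_zero.1 hl))
  have hfirst' := RIFS.ae_forall_eval_law hfirst
  have hfs' := RIFS.ae_forall_eval_law hfs
  refine ⟨s, ?_, ?_⟩
  · filter_upwards [hsep, hfirst', hfs', hslln] with ω hω hr hfω hlim
    simp only [hfω] at hlim
    exact RIFS.hasMinkowskiDim_attractor hrmin hrmax hr hγ hω hlim
  · filter_upwards [hsep, hfirst', hfs', hup, hdown] with ω hω hr hfω h1 h2
    simp only [hfω] at h1 h2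
    obtain ⟨hlow, hupp, havg⟩ :=
      RIFS.minkowskiContents_attractor hrmin hrmax hr hγ hω h1 h2
    exact ⟨hlow, hupp, havg.liminf_eq, havg.limsup_eq, havg⟩
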